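/- Fix $\alpha>0$. Let $\mathcal S_\alpha(\mathbb R)$ be the space of functions $f:\mathbb R\to\mathbb R$ that are $C^\infty$ on $\mathbb R\setminus\{0\}$, continuous from the left at $0$, satisfy $\|f\|_{k,\ell}:=\sup_{u\ne 0}\big|(1+|u|^\ell)f^{(k)}(u)\big|<\infty$ for all integers $k,\ell\ge 0$, and satisfy $f^{(2k+1)}(0^+)=f^{(2k+1)}(0^-)=\alpha\big(f^{(2k)}(0^+)-f^{(2k)}(0^-)\big)$ for all integers $k\ge 0$. Equip it with the topology generated by the norms $\|\cdot\|_{k,\ell}$, and let $\mathcal S'_\alpha(\mathbb R)$ be its topological dual with the strong topology and its Borel $\sigma$-algebra. Let $\rho_0:\mathbb R\to[0,1]$ be smooth ($C^\infty$) and, for $n\ge 1$, let $\nu^n_{\rho_0(\cdot)}$ be the product measure on $\{0,1\}^{\mathbb Z}$ with $\nu^n_{\rho_0(\cdot)}\{\eta:\eta(x)=1\}=\rho_0(x/n)$ for every $x\in\mathbb Z$. For $\eta$ distributed according to $\nu^n_{\rho_0(\cdot)}$ define the initial density fluctuation field $$\mathcal Y^n_0(f)=\frac1{\sqrt n}\sum_{x\in\mathbb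 Z} f\big(\tfrac xn\big)\big(\eta(x)-\mathbb E_{\nu^n_{\rho_0(\cdot)}}[\eta(x)]\big),\qquad f\in\mathcal S_\alpha(\mathbb R).$$ Proposition B.1 (convergence at time zero). As $n\to\infty$, the random elements $\mathcal Y^n_0$ of $\mathcal S'_\alpha(\mathbb R)$ converge in distribution to a random element $\mathcal Y_0$ of $\mathcal S'_\alpha(\mathbb R)$ which is a mean-zero Gaussian field, that is, $(\mathcal Y_0(f))_{f\in\mathcal S_\alpha(\mathbb R)}$ is a centred Gaussian process, with covariance $$\mathbb E\big[\mathcal Y_0(f)\,\mathcal Y_0(g)\big]=\int_{\mathbb R}\chi(\rho_0(u))\,f(u)\,g(u)\,du,\qquad f,g\in\mathcal S_\alpha(\mathbb R),$$ where $\chi(\rho)=\rho(1-\rho)$. -/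

import Mathlib

open MeasureTheory ProbabilityTheory Filter Topology
open scoped ContDiff

noncomputable section

namespace SlowBond

/-! ### The space of test functions `S_α(ℝ)` -/

/-- Membership in `S_α(ℝ)`: smooth off the origin, left-continuous at the origin, all derivatives
rapidly decreasing, and the Robin boundary conditions
`f^{(2k+1)}(0⁺) = f^{(2k+1)}(0⁻) = α (f^{(2k)}(0⁺) - f^{(2k)}(0⁻))` for all `k`. -/
structure IsTestFunction (α : ℝ) (f : ℝ → ℝ) : Prop where
  smooth : ContDiffOn ℝ ∞ f {0}ᶜ
  left_continuous : ContinuousWithinAt f (Set.Iic 0) 0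
  decay : ∀ k l : ℕ, ∃ C : ℝ, ∀ u : ℝ, u ≠ 0 → |(1 + |u| ^ l) * iteratedDeriv k f u| ≤ C
  boundary : ∀ k : ℕ, ∃ p m : ℝ,
    Tendsto (iteratedDeriv (2 * k) f) (𝓝[>] 0) (𝓝 p) ∧
    Tendsto (iteratedDeriv (2 * k) f) (𝓝[<] 0) (𝓝 m) ∧
    Tendsto (iteratedDeriv (2 * k + 1) f) (𝓝[>] 0) (𝓝 (α * (p - m))) ∧
    Tendsto (iteratedDeriv (2 * k + 1) f) (𝓝[<] 0) (𝓝 (α * (p - m)))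

variable {α : ℝ}

lemma IsTestFunction.contDiffAt {f : ℝ → ℝ} (hf : IsTestFunction α f) (k : ℕ) {u : ℝ}
    (hu : u ≠ 0) : ContDiffAt ℝ k f u :=
  (hf.smooth.contDiffAt (isOpen_compl_singleton.mem_nhds hu)).of_le (by exact_mod_cast le_top)

lemma IsTestFunction.zero : IsTestFunction α (0 : ℝ → ℝ) where
  smooth := contDiffOn_const
  left_continuous := continuousWithinAt_const
  decay k l := ⟨0, fun u _ => by simp⟩
  boundary k := ⟨0, 0, by
    have h : ∀ j : ℕ, iteratedDeriv j (0 : ℝ → ℝ) = fun _ => 0 := fun j => by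
      ext u; simp
    simp [h]⟩

lemma iteratedDeriv_add_off {f g : ℝ → ℝ} (hf : IsTestFunction α f) (hg : IsTestFunction α g)
    (k : ℕ) {u : ℝ} (hu : u ≠ 0) :
    iteratedDeriv k (f + g) u = iteratedDeriv k f u + iteratedDeriv k g u :=
  iteratedDeriv_add (hf.contDiffAt k hu) (hg.contDiffAt k hu)

lemma IsTestFunction.add {f g : ℝ → ℝ} (hf : IsTestFunction α f) (hg : IsTestFunction α g) :
    IsTestFunction α (f + g) where
  smooth := hf.smooth.add hg.smooth
  left_continuous := hf.left_continuous.add hg.left_continuous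
  decay k l := by
    obtain ⟨C, hC⟩ := hf.decay k l
    obtain ⟨D, hD⟩ := hg.decay k l
    refine ⟨C + D, fun u hu => ?_⟩
    rw [iteratedDeriv_add_off hf hg k hu, mul_add]
    exact (abs_add_le _ _).trans (add_le_add (hC u hu) (hD u hu))
  boundary k := by
    obtain ⟨p, m, h1, h2, h3, h4⟩ := hf.boundary k
    obtain ⟨p', m', h1', h2', h3', h4'⟩ := hg.boundary k
    have e : α * (p + p' - (m + m')) = α * (p - m) + α * (p' - m') := by ring
    have hR : ∀ j : ℕ, (fun u => iteratedDeriv j f u + iteratedDeriv j g u) =ᶠ[𝓝[>] (0 : ℝ)]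
        iteratedDeriv j (f + g) := fun j => by
      filter_upwards [self_mem_nhdsWithin] with u hu
      exact (iteratedDeriv_add_off hf hg j (ne_of_gt hu)).symm
    have hL : ∀ j : ℕ, (fun u => iteratedDeriv j f u + iteratedDeriv j g u) =ᶠ[𝓝[<] (0 : ℝ)]
        iteratedDeriv j (f + g) := fun j => by
      filter_upwards [self_mem_nhdsWithin] with u hu
      exact (iteratedDeriv_add_off hf hg j (ne_of_lt hu)).symm
    refine ⟨p + p', m + m', ?_, ?_, ?_, ?_⟩
    · exact (h1.add h1').congr' (hR _)
    · exact (h2.add h2').congr' (hL _)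
    · rw [e]; exact (h3.add h3').congr' (hR _)
    · rw [e]; exact (h4.add h4').congr' (hL _)

lemma IsTestFunction.smul {f : ℝ → ℝ} (c : ℝ) (hf : IsTestFunction α f) :
    IsTestFunction α (c • f) where
  smooth := hf.smooth.const_smul c
  left_continuous := hf.left_continuous.const_smul c
  decay k l := by
    obtain ⟨C, hC⟩ := hf.decay k l
    refine ⟨|c| * C, fun u hu => ?_⟩
    rw [iteratedDeriv_const_smul_field, smul_eq_mul, mul_left_comm, abs_mul]
    exact mul_le_mul_of_nonneg_left (hC u hu) (abs_nonneg c)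
  boundary k := by
    obtain ⟨p, m, h1, h2, h3, h4⟩ := hf.boundary k
    have e : α * (c * p - c * m) = c * (α * (p - m)) := by ring
    have h : ∀ j : ℕ, iteratedDeriv j (c • f) = fun u => c * iteratedDeriv j f u := fun j => by
      ext u; rw [iteratedDeriv_const_smul_field, smul_eq_mul]
    refine ⟨c * p, c * m, ?_, ?_, ?_, ?_⟩
    · rw [h]; exact h1.const_mul c
    · rw [h]; exact h2.const_mul c
    · rw [h, e]; exact h3.const_mul c
    · rw [h, e]; exact h4.const_mul c

variable (α) in
/-- `S_α(ℝ)` as a linear subspace of all functions. -/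
def testSubmodule : Submodule ℝ (ℝ → ℝ) where
  carrier := {f | IsTestFunction α f}
  zero_mem' := IsTestFunction.zero
  add_mem' := IsTestFunction.add
  smul_mem' c _ hf := IsTestFunction.smul c hf

/-- The space of test functions `S_α(ℝ)`. This is a type of its own, so that it does not inherit the
topology of pointwise convergence; its topology is the one of the norms `‖f‖_{k,l}` below. -/
def TestSpace (α : ℝ) : Type := testSubmodule α

namespace TestSpace

instance : AddCommGroup (TestSpace α) := inferInstanceAs (AddCommGroup (testSubmodule α))

instance : Module ℝ (TestSpace α) := inferInstanceAs (Module ℝ (testSubmodule α))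

instance : CoeFun (TestSpace α) (fun _ => ℝ → ℝ) := ⟨fun f => f.1⟩

lemma isTestFunction (f : TestSpace α) : IsTestFunction α f := f.2

lemma add_apply (f g : TestSpace α) (u : ℝ) : (f + g) u = f u + g u := rfl

lemma smul_apply (c : ℝ) (f : TestSpace α) (u : ℝ) : (c • f) u = c * f u := rfl

/-- `‖f‖_{k,l} = sup_{u ≠ 0} |(1 + |u|^l) f^{(k)}(u)|`. -/
def supNorm (k l : ℕ) (f : TestSpace α) : ℝ :=
  ⨆ u : {u : ℝ // u ≠ 0}, |(1 + |(u : ℝ)| ^ l) * iteratedDeriv k f u|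

lemma bddAbove_supNorm (k l : ℕ) (f : TestSpace α) :
    BddAbove (Set.range fun u : {u : ℝ // u ≠ 0} =>
      |(1 + |(u : ℝ)| ^ l) * iteratedDeriv k f u|) := by
  obtain ⟨C, hC⟩ := f.isTestFunction.decay k l
  exact ⟨C, by rintro _ ⟨u, rfl⟩; exact hC u u.2⟩

lemma le_supNorm (k l : ℕ) (f : TestSpace α) {u : ℝ} (hu : u ≠ 0) :
    |(1 + |u| ^ l) * iteratedDeriv k f u| ≤ supNorm k l f :=
  le_ciSup (bddAbove_supNorm k l f) ⟨u, hu⟩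

instance : Nonempty {u : ℝ // u ≠ 0} := ⟨⟨1, one_ne_zero⟩⟩

variable (α) in
/-- The norms `‖·‖_{k,l}` as a family of seminorms on `S_α(ℝ)`. -/
def seminormFamily : SeminormFamily ℝ (TestSpace α) (ℕ × ℕ) := fun i =>
  Seminorm.of (supNorm i.1 i.2)
    (fun f g => by
      refine ciSup_le fun u => ?_
      have h : iteratedDeriv i.1 (f + g : TestSpace α) u =
          iteratedDeriv i.1 f u + iteratedDeriv i.1 g u :=
        iteratedDeriv_add_off f.isTestFunction g.isTestFunction i.1 u.2
      rw [h, mul_add]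
      exact (abs_add_le _ _).trans
        (add_le_add (le_supNorm i.1 i.2 f u.2) (le_supNorm i.1 i.2 g u.2)))
    (fun c f => by
      rw [supNorm, supNorm, Real.norm_eq_abs, Real.mul_iSup_of_nonneg (abs_nonneg c)]
      refine iSup_congr fun u => ?_
      have h : iteratedDeriv i.1 (c • f : TestSpace α) u = c * iteratedDeriv i.1 f u :=
        iteratedDeriv_const_smul_field c _
      rw [h, mul_left_comm, abs_mul])

/-- The locally convex topology of `S_α(ℝ)` generated by the norms `‖·‖_{k,l}`. -/
instance : TopologicalSpace (TestSpace α) := (seminormFamily α).moduleFilterBasis.topology'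

variable (α) in
lemma withSeminorms : WithSeminorms (seminormFamily α) := ⟨rfl⟩

instance : IsTopologicalAddGroup (TestSpace α) :=
  (seminormFamily α).addGroupFilterBasis.isTopologicalAddGroup

instance : ContinuousSMul ℝ (TestSpace α) := by
  rw [(withSeminorms α).withSeminorms_eq]
  exact (seminormFamily α).moduleFilterBasis.continuousSMul

lemma abs_le_supNorm (l : ℕ) (f : TestSpace α) {u : ℝ} (hu : u ≠ 0) :
    (1 + |u| ^ l) * |f u| ≤ supNorm 0 l f := by
  have h := le_supNorm 0 l f hu
  rwa [iteratedDeriv_zero, abs_mul, abs_of_nonneg (by positivity)] at h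

lemma abs_zero_le_supNorm (f : TestSpace α) : |f 0| ≤ supNorm 0 2 f := by
  have h : Tendsto (fun u => |f u|) (𝓝[<] 0) (𝓝 |f 0|) :=
    (f.isTestFunction.left_continuous.mono Set.Iio_subset_Iic_self).tendsto.abs
  refine le_of_tendsto h ?_
  filter_upwards [self_mem_nhdsWithin] with u hu
  have h := abs_le_supNorm 2 f (ne_of_lt hu)
  nlinarith [abs_nonneg (f u), sq_nonneg |u|]

lemma abs_le (f : TestSpace α) (u : ℝ) : |f u| ≤ supNorm 0 2 f * (1 + u ^ 2)⁻¹ := by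
  rw [← div_eq_mul_inv, le_div_iff₀ (by positivity)]
  rcases eq_or_ne u 0 with rfl | hu
  · simpa using abs_zero_le_supNorm f
  · have h := abs_le_supNorm 2 f hu
    rw [sq_abs] at h
    linarith

end TestSpace

/-! ### The dual space `S'_α(ℝ)` -/

/-- The topological dual `S'_α(ℝ)`, with its strong topology, that of uniform convergence on bounded
subsets of `S_α(ℝ)` (the topology that Mathlib puts on spaces of continuous linear maps). -/
abbrev DualSpace (α : ℝ) : Type := TestSpace α →L[ℝ] ℝ

/-- `S'_α(ℝ)` carries the Borel σ-algebra. -/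
instance : MeasurableSpace (DualSpace α) := borel _

instance : BorelSpace (DualSpace α) := ⟨rfl⟩

/-! ### Configurations, initial measures and the density fluctuation field -/

/-- The state space `Ω = {0,1}^ℤ`; `true` means that the site is occupied. -/
abbrev Config : Type := ℤ → Bool

/-- The occupation variable `η(x) ∈ {0,1}` as a real number. -/
def occ (η : Config) (x : ℤ) : ℝ := if η x then 1 else 0

/-- The slowly varying Bernoulli product measure `ν^n_{ρ₀(·)}`: under it the `η(x)`, `x ∈ ℤ`, are
independent and `η(x) = 1` with probability `ρ₀(x/n)`. -/
def slowlyVaryingBernoulli (ρ₀ : ℝ → unitInterval) (n : ℕ) : Measure Config :=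
  Measure.infinitePi fun x : ℤ => bernoulliMeasure true false (ρ₀ (x / n))

instance (ρ₀ : ℝ → unitInterval) (n : ℕ) : IsProbabilityMeasure (slowlyVaryingBernoulli ρ₀ n) := by
  unfold slowlyVaryingBernoulli; infer_instance

/-- The initial mean occupation `ρ^n_0(x) = E_μ[η(x)]` under the initial measure `μ`. -/
def meanOcc (μ : Measure Config) (x : ℤ) : ℝ := ∫ η, occ η x ∂μ

lemma abs_occ_sub_meanOcc_le (μ : Measure Config) [IsProbabilityMeasure μ] (η : Config) (x : ℤ) :
    |occ η x - meanOcc μ x| ≤ 1 := by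
  have h0 : ∀ η, 0 ≤ occ η x := fun η => by unfold occ; split_ifs <;> norm_num
  have h1 : ∀ η, occ η x ≤ 1 := fun η => by unfold occ; split_ifs <;> norm_num
  have m0 : 0 ≤ meanOcc μ x := integral_nonneg h0
  have m1 : meanOcc μ x ≤ 1 := by
    have h := norm_integral_le_of_norm_le_const (μ := μ) (f := fun η => occ η x) (C := 1)
      (Eventually.of_forall fun η => by rw [Real.norm_eq_abs, abs_of_nonneg (h0 η)]; exact h1 η)
    rw [Real.norm_eq_abs, probReal_univ, mul_one] at h
    exact (le_abs_self _).trans h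
  rw [abs_le]
  constructor <;> linarith [h0 η, h1 η]

lemma summable_weight {n : ℕ} (hn : n ≠ 0) :
    Summable fun x : ℤ => (1 + ((x : ℝ) / n) ^ 2)⁻¹ := by
  have hs : Summable fun x : ℤ => (n : ℝ) ^ 2 * (1 / (x : ℝ) ^ 2) :=
    (Real.summable_one_div_int_pow.mpr one_lt_two).mul_left _
  have hn' : (0 : ℝ) < n := by positivity
  refine Summable.of_norm_bounded_eventually hs ?_
  have : ∀ᶠ x : ℤ in cofinite, x ≠ 0 := by
    simpa using (Set.finite_singleton (0 : ℤ)).compl_mem_cofinite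
  filter_upwards [this] with x hx
  have hx' : (x : ℝ) ≠ 0 := by exact_mod_cast hx
  have hx2 : (0 : ℝ) < (x : ℝ) ^ 2 := by positivity
  rw [Real.norm_eq_abs, abs_of_nonneg (by positivity), mul_one_div, div_pow,
    inv_le_comm₀ (by positivity) (by positivity), inv_div]
  linarith

lemma norm_field_term_le (n : ℕ) (μ : Measure Config) [IsProbabilityMeasure μ]
    (η : Config) (f : TestSpace α) (x : ℤ) :
    ‖f ((x : ℝ) / n) * (occ η x - meanOcc μ x)‖ ≤
      TestSpace.supNorm 0 2 f * (1 + ((x : ℝ) / n) ^ 2)⁻¹ := by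
  rw [norm_mul, Real.norm_eq_abs, Real.norm_eq_abs]
  calc _ ≤ |f ((x : ℝ) / n)| * 1 :=
        mul_le_mul_of_nonneg_left (abs_occ_sub_meanOcc_le μ η x) (abs_nonneg _)
    _ ≤ _ := by rw [mul_one]; exact f.abs_le _

lemma summable_field {n : ℕ} (hn : n ≠ 0) (μ : Measure Config) [IsProbabilityMeasure μ]
    (η : Config) (f : TestSpace α) :
    Summable fun x : ℤ => f ((x : ℝ) / n) * (occ η x - meanOcc μ x) :=
  Summable.of_norm_bounded ((summable_weight hn).mul_left _) (norm_field_term_le n μ η f)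

/-- The value `n^{-1/2} ∑_{x ∈ ℤ} f(x/n) (η(x) - ρ^n_0(x))` (it is `0` for the irrelevant index
`n = 0`). -/
def fieldValue (n : ℕ) (μ : Measure Config) (η : Config) (f : TestSpace α) : ℝ :=
  (1 / √(n : ℝ)) * ∑' x : ℤ, f ((x : ℝ) / n) * (occ η x - meanOcc μ x)

/-- The linear functional `f ↦ n^{-1/2} ∑_{x ∈ ℤ} f(x/n) (η(x) - ρ^n_0(x))`. -/
def fieldLinear (α : ℝ) (n : ℕ) (μ : Measure Config) [IsProbabilityMeasure μ] (η : Config) :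
    TestSpace α →ₗ[ℝ] ℝ where
  toFun := fieldValue n μ η
  map_add' f g := by
    rcases eq_or_ne n 0 with rfl | hn
    · simp [fieldValue]
    · simp only [fieldValue, TestSpace.add_apply, add_mul]
      rw [(summable_field hn μ η f).tsum_add (summable_field hn μ η g), mul_add]
  map_smul' c f := by
    simp only [fieldValue, TestSpace.smul_apply, mul_assoc, tsum_mul_left, RingHom.id_apply,
      smul_eq_mul]
    ring

lemma continuous_fieldLinear (n : ℕ) (μ : Measure Config) [IsProbabilityMeasure μ] (η : Config) :
    Continuous (fieldLinear α n μ η) := by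
  rcases eq_or_ne n 0 with rfl | hn
  · have h : (fieldLinear α 0 μ η : TestSpace α → ℝ) = fun _ => 0 := by
      ext f; simp [fieldLinear, fieldValue]
    exact h ▸ continuous_const
  · let C : ℝ := (1 / √(n : ℝ)) * ∑' x : ℤ, (1 + ((x : ℝ) / n) ^ 2)⁻¹
    have hC : 0 ≤ C := mul_nonneg (by positivity) (tsum_nonneg fun x => by positivity)
    refine WithSeminorms.continuous_normedSpace_rng ℝ (TestSpace.withSeminorms α)
      (fieldLinear α n μ η) ⟨{(0, 2)}, ⟨C, hC⟩, fun f => ?_⟩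
    rw [Finset.sup_singleton]
    change ‖fieldValue n μ η f‖ ≤ C * TestSpace.supNorm 0 2 f
    have h := tsum_of_norm_bounded ((summable_weight hn).mul_left _).hasSum
      (norm_field_term_le n μ η f)
    rw [tsum_mul_left] at h
    rw [fieldValue, norm_mul, Real.norm_eq_abs (1 / _), abs_of_nonneg (by positivity)]
    calc _ ≤ (1 / √(n : ℝ)) * _ := mul_le_mul_of_nonneg_left h (by positivity)
      _ = _ := by simp only [C]; ring

/-- The density fluctuation field at time zero, as an element of `S'_α(ℝ)`, when the initial
configuration `η` is sampled from `μ`. -/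
def densityField (α : ℝ) (n : ℕ) (μ : Measure Config) [IsProbabilityMeasure μ] (η : Config) :
    DualSpace α :=
  ⟨fieldLinear α n μ η, continuous_fieldLinear n μ η⟩

/-! ### The limiting Gaussian field -/

/-- The static compressibility `χ(ρ) = ρ (1 - ρ)`. -/
def chi (r : ℝ) : ℝ := r * (1 - r)

/-- The random element `Y` of `S'_α(ℝ)` is a mean-zero Gaussian field, i.e. `(Y(f))_f` is a centred
Gaussian process indexed by the test functions, with covariance
`E[Y(f) Y(g)] = ∫ χ(ρ₀(u)) f(u) g(u) du`. -/
structure IsInitialGaussianField {Ω : Type*} [MeasurableSpace Ω] (ρ₀ : ℝ → unitInterval)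
    (Y : Ω → DualSpace α) (P : Measure Ω) : Prop where
  measurable : Measurable Y
  gaussian : IsGaussianProcess (fun (f : TestSpace α) (w : Ω) => Y w f) P
  mean_zero : ∀ f : TestSpace α, ∫ w, Y w f ∂P = 0
  covariance : ∀ f g : TestSpace α,
    ∫ w, Y w f * Y w g ∂P = ∫ u : ℝ, chi (ρ₀ u) * f u * g u

end SlowBond

end

noncomputable section

namespace SlowBond

/-! ### Infinite sums of bounded independent centred random variables -/

section IndependentSums

/-! The field is realised in a Hilbert space, and the limit theorem is proved there. A test function
`f` vanishes at infinity, so `f u` is the integral of `f'` over `(-∞, u]` when `u ≤ 0`, and minus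
the integral of `f'` over `(u, ∞)` when `u > 0`; neither integral crosses the jump at `0`. With the
weight `(1 + v²)²` this reads `f u = ⟪K_u, T f⟫` in `L²(ℝ)`, where `T f = (1 + v²)² f'` and `K_u` is
`±(1 + v²)⁻²` on a half-line (`inner_kernel_weightedDeriv`). Hence the fluctuation field is `T*
Z_n`, where `Z_n = n^{-1/2} ∑ (η(x) - ρ₀(x/n)) K_{x/n}` is a random vector of `L²(ℝ)`. Since `T` is
continuous, so is its transpose `T*` into the strong dual, and by continuous mapping it suffices
that `Z_n` converges in law in `L²(ℝ)`.

That convergence follows from two facts, joined in `exists_tendsto_of_isTightMeasureSet_of_charFun`.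

Characteristic functions (`tendsto_charFun_kernelFieldLaw`): `⟪Z_n, h⟫` is a sum of independent
centred variables with weights of size `n^{-1/2}`. A Lyapunov estimate replaces its characteristic
function by a Gaussian one, whose variance is a Riemann sum for `∫ χ(ρ₀) ⟪K_u, h⟫²`.

Tightness (`isTightMeasureSet_kernelFieldLaw`): `K_u` takes totally bounded values on bounded
intervals and decays like `(1 + u²)⁻¹`, so a finite-dimensional subspace approximates every `K_u`
with a small integrable error. By orthogonality of the summands the same subspace approximates all
`Z_n` in mean square.

The limit law is Gaussian, and polarisation together with the formula for `f u` gives the covariance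
of its image under `T*`. -/

lemma norm_finset_prod_sub_prod_le {ι : Type*} (s : Finset ι) {a b : ι → ℂ}
    (ha : ∀ i ∈ s, ‖a i‖ ≤ 1) (hb : ∀ i ∈ s, ‖b i‖ ≤ 1) :
    ‖∏ i ∈ s, a i - ∏ i ∈ s, b i‖ ≤ ∑ i ∈ s, ‖a i - b i‖ := by
  classical
  induction s using Finset.induction_on with
  | empty => simp
  | insert j s hj ih =>
    have ha' : ∀ i ∈ s, ‖a i‖ ≤ 1 := fun i hi => ha i (Finset.mem_insert_of_mem hi)
    have hb' : ∀ i ∈ s, ‖b i‖ ≤ 1 := fun i hi => hb i (Finset.mem_insert_of_mem hi)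
    rw [Finset.prod_insert hj, Finset.prod_insert hj, Finset.sum_insert hj]
    have e : a j * ∏ i ∈ s, a i - b j * ∏ i ∈ s, b i
        = (a j - b j) * ∏ i ∈ s, a i + b j * (∏ i ∈ s, a i - ∏ i ∈ s, b i) := by ring
    have hp : ‖∏ i ∈ s, a i‖ ≤ 1 := by
      rw [norm_prod]; exact Finset.prod_le_one (fun _ _ => norm_nonneg _) ha'
    rw [e]
    refine (norm_add_le _ _).trans (add_le_add ?_ ?_)
    · rw [norm_mul]; exact mul_le_of_le_one_right (norm_nonneg _) hp
    · rw [norm_mul]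
      exact (mul_le_of_le_one_left (norm_nonneg _) (hb j (Finset.mem_insert_self _ _))).trans
        (ih ha' hb')

lemma norm_exp_mul_I_sub_taylor_le {y : ℝ} (hy : |y| ≤ 1) :
    ‖Complex.exp (y * Complex.I) - (1 + y * Complex.I - (y ^ 2 / 2 : ℝ))‖ ≤ 3 * |y| ^ 3 := by
  have h := Complex.norm_exp_sub_sum_le_norm_mul_exp (y * Complex.I) 3
  have hn : ‖(y : ℂ) * Complex.I‖ = |y| := by simp
  have e : ∑ m ∈ Finset.range 3, ((y : ℂ) * Complex.I) ^ m / (m.factorial : ℂ)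
      = 1 + y * Complex.I - (y ^ 2 / 2 : ℝ) := by
    simp only [Finset.sum_range_succ, Finset.range_zero, Finset.sum_empty]
    simp [mul_pow, Nat.factorial]
    ring
  rw [e, hn] at h
  have h3 : Real.exp |y| ≤ 3 :=
    (Real.exp_le_exp.2 hy).trans (by linarith [Real.exp_one_lt_d9])
  nlinarith [pow_nonneg (abs_nonneg y) 3]

variable {Ω : Type*} [MeasurableSpace Ω] {μ : Measure Ω} [IsProbabilityMeasure μ]

/-- Both terms are compared with `1 - v a² / 2`. Centring removes the linear Taylor term, which
leaves an error `3|a|³`; the real exponential differs by at most `(v a² / 2)² ≤ a⁴ ≤ |a|³`. -/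
lemma norm_integral_exp_sub_exp_le {X : Ω → ℝ} (hX : Measurable X) (hb : ∀ w, |X w| ≤ 1)
    (h0 : ∫ w, X w ∂μ = 0) {a : ℝ} (ha : |a| ≤ 1) :
    ‖∫ w, Complex.exp ((a * X w : ℝ) * Complex.I) ∂μ
      - Complex.exp (-((∫ w, X w ^ 2 ∂μ) * a ^ 2 / 2 : ℝ))‖ ≤ 4 * |a| ^ 3 := by
  set v := ∫ w, X w ^ 2 ∂μ
  have iX : Integrable X μ :=
    Integrable.of_bound hX.aestronglyMeasurable 1 (Eventually.of_forall hb)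
  have hsq : ∀ w, X w ^ 2 ≤ 1 := fun w => by
    rw [← sq_abs]; exact pow_le_one₀ (abs_nonneg _) (hb w)
  have iX2 : Integrable (fun w => X w ^ 2) μ :=
    Integrable.of_bound (hX.pow_const 2).aestronglyMeasurable 1
      (Eventually.of_forall fun w => by rw [Real.norm_eq_abs, abs_of_nonneg (sq_nonneg _)]
                                        exact hsq w)
  have v0 : 0 ≤ v := integral_nonneg fun w => sq_nonneg _
  have v1 : v ≤ 1 := by
    have := integral_mono iX2 (integrable_const (1 : ℝ)) hsq
    simpa using this
  have iE : Integrable (fun w => Complex.exp ((a * X w : ℝ) * Complex.I)) μ :=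
    Integrable.of_bound (by fun_prop) 1
      (Eventually.of_forall fun w => by rw [Complex.norm_exp_ofReal_mul_I])
  have i1 : Integrable (fun w => ((a * X w : ℝ) : ℂ) * Complex.I) μ :=
    (iX.const_mul a).ofReal.mul_const _
  have i2 : Integrable (fun w => (((a * X w) ^ 2 / 2 : ℝ) : ℂ)) μ := by
    have := (iX2.const_mul (a ^ 2 / 2)).ofReal (𝕜 := ℂ)
    refine this.congr (Eventually.of_forall fun w => ?_)
    simp only [Complex.coe_algebraMap]
    congr 1; ring
  have i3 : Integrable (fun w => 1 + ((a * X w : ℝ) : ℂ) * Complex.I) μ :=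
    (integrable_const _).add i1
  have iT : Integrable (fun w => 1 + ((a * X w : ℝ) : ℂ) * Complex.I
      - (((a * X w) ^ 2 / 2 : ℝ) : ℂ)) μ := i3.sub i2
  have eT : ∫ w, (1 + ((a * X w : ℝ) : ℂ) * Complex.I - (((a * X w) ^ 2 / 2 : ℝ) : ℂ)) ∂μ
      = ((1 - v * a ^ 2 / 2 : ℝ) : ℂ) := by
    rw [integral_sub i3 i2, integral_add (integrable_const _) i1,
      integral_mul_const, integral_complex_ofReal, integral_complex_ofReal, integral_const_mul, h0]
    have : ∫ w, (a * X w) ^ 2 / 2 ∂μ = v * a ^ 2 / 2 := by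
      rw [← integral_mul_const, ← integral_div]
      congr 1; ext w; ring
    rw [this]
    simp
  have b1 : ‖∫ w, Complex.exp ((a * X w : ℝ) * Complex.I) ∂μ - ((1 - v * a ^ 2 / 2 : ℝ) : ℂ)‖
      ≤ 3 * |a| ^ 3 := by
    rw [← eT, ← integral_sub iE iT]
    refine (norm_integral_le_of_norm_le_const (C := 3 * |a| ^ 3)
      (Eventually.of_forall fun w => ?_)).trans (by simp)
    have hy : |a * X w| ≤ |a| := by
      rw [abs_mul]; exact mul_le_of_le_one_right (abs_nonneg _) (hb w)
    refine (norm_exp_mul_I_sub_taylor_le (hy.trans ha)).trans ?_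
    gcongr
  have a2 : a ^ 2 ≤ 1 := by rw [← sq_abs]; exact pow_le_one₀ (abs_nonneg _) ha
  have b2 : ‖((1 - v * a ^ 2 / 2 : ℝ) : ℂ) - Complex.exp (-((v * a ^ 2 / 2 : ℝ) : ℂ))‖
      ≤ |a| ^ 3 := by
    have hy : ‖-(v * a ^ 2 / 2)‖ ≤ 1 := by
      rw [norm_neg, Real.norm_eq_abs, abs_of_nonneg (by positivity)]
      nlinarith [sq_nonneg a]
    have h := Real.norm_exp_sub_one_sub_id_le hy
    have e : ((1 - v * a ^ 2 / 2 : ℝ) : ℂ) - Complex.exp (-((v * a ^ 2 / 2 : ℝ) : ℂ))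
        = ((-(Real.exp (-(v * a ^ 2 / 2)) - 1 - -(v * a ^ 2 / 2)) : ℝ) : ℂ) := by
      push_cast; ring
    rw [e, Complex.norm_real, norm_neg]
    refine h.trans ?_
    rw [norm_neg, Real.norm_eq_abs, sq_abs]
    have h3 : |a| ^ 4 ≤ |a| ^ 3 := pow_le_pow_of_le_one (abs_nonneg _) ha (by norm_num)
    have h4 : |a| ^ 4 = a ^ 4 := by rw [← abs_pow]; exact abs_of_nonneg (by positivity)
    rw [h4] at h3
    have : (v * a ^ 2 / 2) ^ 2 ≤ a ^ 4 := by
      have : v ^ 2 ≤ 1 := pow_le_one₀ v0 v1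
      nlinarith [pow_nonneg (sq_nonneg a) 2, sq_nonneg (a ^ 2)]
    linarith
  calc _ ≤ _ := norm_sub_le_norm_sub_add_norm_sub _ ((1 - v * a ^ 2 / 2 : ℝ) : ℂ) _
    _ ≤ 3 * |a| ^ 3 + |a| ^ 3 := add_le_add b1 b2
    _ = _ := by ring

variable {ι : Type*} [Countable ι] {X : ι → Ω → ℝ}

/-- Gaussian approximation of the characteristic function of a weighted sum of bounded independent
centred variables, with the Lyapunov error term. -/
lemma norm_integral_exp_tsum_sub_exp_le (hX : ∀ i, Measurable (X i)) (hb : ∀ i w, |X i w| ≤ 1)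
    (h0 : ∀ i, ∫ w, X i w ∂μ = 0) (hi : iIndepFun X μ) {a : ι → ℝ} (ha : ∀ i, |a i| ≤ 1)
    (hs : Summable fun i => |a i|) :
    ‖∫ w, Complex.exp ((∑' i, a i * X i w : ℝ) * Complex.I) ∂μ
      - Complex.exp (-(∑' i, (∫ w, X i w ^ 2 ∂μ) * a i ^ 2 / 2 : ℝ))‖ ≤ 4 * ∑' i, |a i| ^ 3 := by
  have v0 : ∀ i, 0 ≤ ∫ w, X i w ^ 2 ∂μ := fun i => integral_nonneg fun w => sq_nonneg _
  have v1 : ∀ i, ∫ w, X i w ^ 2 ∂μ ≤ 1 := fun i => by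
    have := norm_integral_le_of_norm_le_const (μ := μ) (f := fun w => X i w ^ 2) (C := 1)
      (Eventually.of_forall fun w => by
        rw [norm_pow]; exact pow_le_one₀ (norm_nonneg _) (hb i w))
    simpa [abs_of_nonneg (v0 i)] using this
  have hs3 : Summable fun i => |a i| ^ 3 :=
    Summable.of_nonneg_of_le (fun i => by positivity)
      (fun i => by simpa using pow_le_pow_of_le_one (abs_nonneg _) (ha i) (show 1 ≤ 3 by norm_num))
      hs
  have hs2 : Summable fun i => (∫ w, X i w ^ 2 ∂μ) * a i ^ 2 / 2 := by
    refine Summable.of_nonneg_of_le (fun i => by have := v0 i; positivity) (fun i => ?_) hs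
    have h2 : |a i| ^ 2 ≤ |a i| := by
      simpa using pow_le_pow_of_le_one (abs_nonneg _) (ha i) (show 1 ≤ 2 by norm_num)
    rw [sq_abs] at h2
    nlinarith [v0 i, v1 i, sq_nonneg (a i), mul_nonneg (sub_nonneg.2 (v1 i)) (sq_nonneg (a i))]
  have hsX : ∀ w, Summable fun i => a i * X i w := fun w =>
    Summable.of_norm_bounded hs fun i => by
      rw [norm_mul]; exact mul_le_of_le_one_right (abs_nonneg _) (hb i w)
  -- Independence factorises the characteristic function of a finite sum, here evaluated at `1`.
  have hfin : ∀ s : Finset ι,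
      ∫ w, Complex.exp ((∑ i ∈ s, a i * X i w : ℝ) * Complex.I) ∂μ
        = ∏ i ∈ s, ∫ w, Complex.exp ((a i * X i w : ℝ) * Complex.I) ∂μ := fun s => by
    have hm : ∀ i, Measurable fun w => a i * X i w := fun i => (hX i).const_mul _
    have hi' : iIndepFun (fun i w => a i * X i w) μ :=
      hi.comp (fun i x => a i * x) fun i => measurable_const_mul _
    have h := congrFun (iIndepFun.charFun_map_fun_finsetSum_eq_prod (s := s)
      (fun i _ => (hm i).aemeasurable) (hi'.restrict s)) 1
    rw [Finset.prod_apply, charFun_apply_real,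
      integral_map (Finset.measurable_fun_sum s fun i _ => hm i).aemeasurable (by fun_prop)] at h
    simp only [Complex.ofReal_one, one_mul] at h
    rw [h]
    refine Finset.prod_congr rfl fun i _ => ?_
    rw [charFun_apply_real, integral_map (hm i).aemeasurable (by fun_prop)]
    simp
  have t1 : Tendsto (fun s : Finset ι =>
      ∫ w, Complex.exp ((∑ i ∈ s, a i * X i w : ℝ) * Complex.I) ∂μ) atTop
      (𝓝 (∫ w, Complex.exp ((∑' i, a i * X i w : ℝ) * Complex.I) ∂μ)) := by
    refine tendsto_integral_filter_of_dominated_convergence (fun _ => (1 : ℝ))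
      (Eventually.of_forall fun s => ?_) (Eventually.of_forall fun s =>
        Eventually.of_forall fun w => ?_) (integrable_const _) (Eventually.of_forall fun w => ?_)
    · have := Finset.measurable_fun_sum s fun i _ => (hX i).const_mul (a i)
      exact (by fun_prop : Measurable _).aestronglyMeasurable
    · rw [Complex.norm_exp_ofReal_mul_I]
    · have hc : Continuous fun y : ℝ => Complex.exp (y * Complex.I) := by fun_prop
      exact (hc.tendsto _).comp (hsX w).hasSum
  have t2 : Tendsto (fun s : Finset ι =>
      Complex.exp (-(∑ i ∈ s, (∫ w, X i w ^ 2 ∂μ) * a i ^ 2 / 2 : ℝ))) atTop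
      (𝓝 (Complex.exp (-(∑' i, (∫ w, X i w ^ 2 ∂μ) * a i ^ 2 / 2 : ℝ)))) := by
    have hc : Continuous fun y : ℝ => Complex.exp (-(y : ℂ)) := by fun_prop
    exact (hc.tendsto _).comp hs2.hasSum
  -- The bound is proved for finite partial sums, where both terms are products of factors of
  -- modulus at most `1` and the difference telescopes; it then passes to the limit.
  refine le_of_tendsto (t1.sub t2).norm (Eventually.of_forall fun s => ?_)
  have e2 : Complex.exp (-(∑ i ∈ s, (∫ w, X i w ^ 2 ∂μ) * a i ^ 2 / 2 : ℝ))
      = ∏ i ∈ s, Complex.exp (-((∫ w, X i w ^ 2 ∂μ) * a i ^ 2 / 2 : ℝ)) := by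
    rw [← Complex.exp_sum]
    push_cast
    rw [Finset.sum_neg_distrib]
  rw [hfin, e2]
  refine (norm_finset_prod_sub_prod_le s (fun i _ => ?_) (fun i _ => ?_)).trans ?_
  · refine (norm_integral_le_of_norm_le_const (C := 1) (Eventually.of_forall fun w => ?_)).trans
      (by simp)
    rw [Complex.norm_exp_ofReal_mul_I]
  · rw [← Complex.ofReal_neg, Complex.norm_exp_ofReal, Real.exp_le_one_iff]
    have := v0 i
    have : 0 ≤ (∫ w, X i w ^ 2 ∂μ) * a i ^ 2 / 2 := by positivity
    linarith
  · calc _ ≤ ∑ i ∈ s, 4 * |a i| ^ 3 := Finset.sum_le_sum fun i _ =>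
          norm_integral_exp_sub_exp_le (hX i) (hb i) (h0 i) (ha i)
      _ = 4 * ∑ i ∈ s, |a i| ^ 3 := by rw [Finset.mul_sum]
      _ ≤ _ := by
        gcongr
        exact hs3.sum_le_tsum s fun i _ => by positivity

/-! ### Hilbert-space valued sums -/

variable {H : Type*} [NormedAddCommGroup H] [InnerProductSpace ℝ H] [CompleteSpace H]

omit [MeasurableSpace Ω] [Countable ι] in
lemma summable_smul_of_abs_le_one (hb : ∀ i w, |X i w| ≤ 1) {c : ι → H}
    (hc : Summable fun i => ‖c i‖) (w : Ω) : Summable fun i => X i w • c i :=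
  Summable.of_norm_bounded hc fun i => by
    rw [norm_smul]; exact mul_le_of_le_one_left (norm_nonneg _) (hb i w)

omit [MeasurableSpace Ω] [Countable ι] [CompleteSpace H] in
lemma norm_tsum_smul_le (hb : ∀ i w, |X i w| ≤ 1) {c : ι → H}
    (hc : Summable fun i => ‖c i‖) (w : Ω) : ‖∑' i, X i w • c i‖ ≤ ∑' i, ‖c i‖ :=
  tsum_of_norm_bounded hc.hasSum fun i => by
    rw [norm_smul]; exact mul_le_of_le_one_left (norm_nonneg _) (hb i w)

lemma measurable_tsum_smul [MeasurableSpace H] [BorelSpace H] [SecondCountableTopology H]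
    (hX : ∀ i, Measurable (X i)) (hb : ∀ i w, |X i w| ≤ 1) {c : ι → H}
    (hc : Summable fun i => ‖c i‖) : Measurable fun w => ∑' i, X i w • c i := by
  refine measurable_of_tendsto_metrizable' (u := (atTop : Filter (Finset ι)))
    (f := fun s w => ∑ i ∈ s, X i w • c i)
    (fun s => Finset.measurable_fun_sum s fun i _ => (hX i).smul_const _) ?_
  rw [tendsto_pi_nhds]
  exact fun w => (summable_smul_of_abs_le_one hb hc w).hasSum

/-- The second moment of a sum of bounded independent centred vectors. -/
lemma integral_norm_sq_tsum_le [MeasurableSpace H] [BorelSpace H] [SecondCountableTopology H]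
    (hX : ∀ i, Measurable (X i)) (hb : ∀ i w, |X i w| ≤ 1)
    (h0 : ∀ i, ∫ w, X i w ∂μ = 0) (hi : iIndepFun X μ) {c : ι → H}
    (hc : Summable fun i => ‖c i‖) (hc2 : Summable fun i => ‖c i‖ ^ 2) :
    ∫ w, ‖∑' i, X i w • c i‖ ^ 2 ∂μ ≤ ∑' i, ‖c i‖ ^ 2 := by
  classical
  have hms : ∀ s : Finset ι, Measurable fun w => ∑ i ∈ s, X i w • c i := fun s =>
    Finset.measurable_fun_sum s fun i _ => (hX i).smul_const _
  have t : Tendsto (fun s : Finset ι => ∫ w, ‖∑ i ∈ s, X i w • c i‖ ^ 2 ∂μ) atTop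
      (𝓝 (∫ w, ‖∑' i, X i w • c i‖ ^ 2 ∂μ)) := by
    refine tendsto_integral_filter_of_dominated_convergence (fun _ => (∑' i, ‖c i‖) ^ 2)
      (Eventually.of_forall fun s => ?_) (Eventually.of_forall fun s =>
        Eventually.of_forall fun w => ?_) (integrable_const _) (Eventually.of_forall fun w => ?_)
    · exact ((hms s).norm.pow_const 2).aestronglyMeasurable
    · rw [norm_pow, norm_norm]
      gcongr
      refine (norm_sum_le _ _).trans ((Finset.sum_le_sum fun i _ => ?_).trans
        (hc.sum_le_tsum s fun i _ => norm_nonneg _))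
      rw [norm_smul]; exact mul_le_of_le_one_left (norm_nonneg _) (hb i w)
    · exact ((summable_smul_of_abs_le_one hb hc w).hasSum.norm).pow 2
  refine le_of_tendsto t (Eventually.of_forall fun s => ?_)
  have iXX : ∀ i j, Integrable (fun w => X i w * X j w) μ := fun i j =>
    Integrable.of_bound ((hX i).mul (hX j)).aestronglyMeasurable 1
      (Eventually.of_forall fun w => by
        rw [norm_mul]; exact mul_le_one₀ (hb i w) (norm_nonneg _) (hb j w))
  have e : ∀ w, ‖∑ i ∈ s, X i w • c i‖ ^ 2
      = ∑ i ∈ s, ∑ j ∈ s, X i w * X j w * inner ℝ (c i) (c j) := fun w => by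
    rw [← real_inner_self_eq_norm_sq, sum_inner]
    simp_rw [inner_sum, real_inner_smul_left, real_inner_smul_right]
    refine Finset.sum_congr rfl fun i _ => Finset.sum_congr rfl fun j _ => by ring
  simp_rw [e]
  rw [integral_finsetSum _ fun i _ => integrable_finsetSum _ fun j _ => (iXX i j).mul_const _]
  -- Off-diagonal terms factor by independence and vanish by centring; on the diagonal `X i ^ 2 ≤
  -- 1`.
  calc _ = ∑ i ∈ s, (∫ w, X i w * X i w ∂μ) * ‖c i‖ ^ 2 := by
        refine Finset.sum_congr rfl fun i his => ?_
        rw [integral_finsetSum _ fun j _ => (iXX i j).mul_const _,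
          Finset.sum_eq_single_of_mem i his]
        · rw [integral_mul_const, real_inner_self_eq_norm_sq]
        · intro j _ hji
          rw [integral_mul_const, (hi.indepFun hji.symm).integral_fun_mul_eq_mul_integral
            (hX i).aestronglyMeasurable (hX j).aestronglyMeasurable, h0 i]
          simp
    _ ≤ ∑ i ∈ s, ‖c i‖ ^ 2 := by
        refine Finset.sum_le_sum fun i _ => mul_le_of_le_one_left (by positivity) ?_
        have := integral_mono (iXX i i) (integrable_const (1 : ℝ)) fun w => by
          have := abs_le_one_iff_mul_self_le_one.1 (hb i w)
          simpa using this
        simpa using this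
    _ ≤ _ := hc2.sum_le_tsum s fun i _ => by positivity

end IndependentSums

/-! ### Riemann sums over the scaled lattice -/

section RiemannSums

/-- The lattice point `v` below `u` satisfies `0 ≤ u - v ≤ 1`, so `u² ≤ 2v² + 2(u - v)² ≤ 2v² + 2`.
This gives one integrable majorant for the step functions of all meshes `1/n`. -/
lemma inv_one_add_floor_sq_le {n : ℕ} (hn : n ≠ 0) (u : ℝ) :
    (1 + ((⌊n * u⌋ : ℝ) / n) ^ 2)⁻¹ ≤ 3 * (1 + u ^ 2)⁻¹ := by
  have hn' : (1 : ℝ) ≤ n := by exact_mod_cast Nat.one_le_iff_ne_zero.2 hn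
  have h1 := Int.floor_le (n * u)
  have h2 := Int.lt_floor_add_one (n * u)
  set v := (⌊n * u⌋ : ℝ) / n
  have hv : (⌊n * u⌋ : ℝ) = n * v := by simp only [v]; field_simp
  rw [hv] at h1 h2
  have h3 : 0 ≤ u - v := by nlinarith
  have h4 : u - v ≤ 1 := by nlinarith
  rw [← div_eq_mul_inv, inv_eq_one_div, div_le_div_iff₀ (by positivity) (by positivity)]
  nlinarith [sq_nonneg (u - 2 * v), mul_nonneg h3 (sub_nonneg.2 h4)]

lemma integrable_comp_floor_of_le {φ : ℝ → ℝ} {C : ℝ}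
    (hφ : ∀ u, |φ u| ≤ C * (1 + u ^ 2)⁻¹) {n : ℕ} (hn : n ≠ 0) :
    Integrable fun u : ℝ => φ ((⌊n * u⌋ : ℝ) / n) := by
  have hC : 0 ≤ C := by
    have := (abs_nonneg _).trans (hφ 0)
    simpa using this
  refine Integrable.mono' ((integrable_inv_one_add_sq.const_mul (3 * C))) ?_
    (Eventually.of_forall fun u => (hφ _).trans ?_)
  · have h1 : Measurable fun u : ℝ => ⌊(n : ℝ) * u⌋ := (measurable_const_mul _).floor
    -- Factoring through `ℤ` makes the step function measurable without any regularity of `φ`.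
    have h2 : Measurable fun k : ℤ => φ ((k : ℝ) / n) := measurable_of_countable _
    exact (h2.comp h1).aestronglyMeasurable
  · calc C * _ ≤ C * (3 * (1 + u ^ 2)⁻¹) :=
          mul_le_mul_of_nonneg_left (inv_one_add_floor_sq_le hn u) hC
      _ = _ := by ring

/-- The step function is constant on each cell `[x/n, (x+1)/n)`, so the Riemann sum is exactly its
integral. Limits of Riemann sums thus become a matter of dominated convergence. -/
lemma hasSum_comp_floor {φ : ℝ → ℝ} {C : ℝ}
    (hφ : ∀ u, |φ u| ≤ C * (1 + u ^ 2)⁻¹) {n : ℕ} (hn : n ≠ 0) :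
    HasSum (fun x : ℤ => (1 / n : ℝ) * φ ((x : ℝ) / n))
      (∫ u : ℝ, φ ((⌊n * u⌋ : ℝ) / n)) := by
  have hn' : (0 : ℝ) < n := by positivity
  have hi := integrable_comp_floor_of_le hφ hn
  have e : ∫ u : ℝ, φ ((⌊n * u⌋ : ℝ) / n) = (1 / n : ℝ) * ∫ u : ℝ, φ ((⌊u⌋ : ℝ) / n) := by
    rw [Measure.integral_comp_mul_left (fun u : ℝ => φ ((⌊u⌋ : ℝ) / n)), smul_eq_mul,
      abs_of_pos (by positivity), one_div]
  rw [e]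
  refine HasSum.mul_left _ ?_
  have hi' : Integrable fun u : ℝ => φ ((⌊u⌋ : ℝ) / n) := by
    have := (integrable_comp_mul_left_iff (fun u : ℝ => φ ((⌊u⌋ : ℝ) / n)) hn'.ne').1 hi
    exact this
  have e2 : (fun x : ℤ => φ ((x : ℝ) / n))
      = fun x : ℤ => ∫ u in (0 + x : ℝ)..(0 + x + 1), φ ((⌊u⌋ : ℝ) / n) := by
    ext x
    have : ∫ u in (0 + x : ℝ)..(0 + x + 1), φ ((⌊u⌋ : ℝ) / n)
        = ∫ u in (0 + x : ℝ)..(0 + x + 1), φ ((x : ℝ) / n) := by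
      rw [intervalIntegral.integral_of_le (by linarith),
        intervalIntegral.integral_of_le (by linarith),
        integral_Ioc_eq_integral_Ioo, integral_Ioc_eq_integral_Ioo]
      refine setIntegral_congr_fun measurableSet_Ioo fun u hu => ?_
      have : ⌊u⌋ = x := Int.floor_eq_iff.2 ⟨by linarith [hu.1], by linarith [hu.2]⟩
      simp only [this]
    rw [this]
    simp
  rw [e2]
  exact hi'.hasSum_intervalIntegral 0

lemma tsum_weight_le {n : ℕ} (hn : n ≠ 0) :
    (1 / n : ℝ) * ∑' x : ℤ, (1 + ((x : ℝ) / n) ^ 2)⁻¹ ≤ 3 * Real.pi := by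
  have hφ : ∀ u : ℝ, |(1 + u ^ 2)⁻¹| ≤ 1 * (1 + u ^ 2)⁻¹ := fun u => by
    rw [abs_of_nonneg (by positivity), one_mul]
  rw [← tsum_mul_left, (hasSum_comp_floor hφ hn).tsum_eq, ← integral_univ_inv_one_add_sq,
    ← integral_const_mul]
  exact integral_mono (integrable_comp_floor_of_le hφ hn)
    (integrable_inv_one_add_sq.const_mul 3) fun u => inv_one_add_floor_sq_le hn u

lemma tendsto_floor_mul_div (u : ℝ) :
    Tendsto (fun n : ℕ => (⌊n * u⌋ : ℝ) / n) atTop (𝓝 u) := by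
  have h : Tendsto (fun n : ℕ => u - 1 / (n : ℝ)) atTop (𝓝 u) := by
    simpa using (tendsto_const_nhds (x := u)).sub
      (tendsto_one_div_atTop_nhds_zero_nat (𝕜 := ℝ))
  refine tendsto_of_tendsto_of_tendsto_of_le_of_le' h tendsto_const_nhds ?_ ?_
  · filter_upwards [eventually_gt_atTop 0] with n hn
    have hn' : (0 : ℝ) < n := by positivity
    rw [sub_le_iff_le_add, ← add_div, le_div_iff₀ hn']
    linarith [Int.lt_floor_add_one (n * u)]
  · filter_upwards [eventually_gt_atTop 0] with n hn
    have hn' : (0 : ℝ) < n := by positivity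
    rw [div_le_iff₀ hn']
    linarith [Int.floor_le (n * u)]

/-- Almost everywhere convergence of the step functions suffices, so a jump of `φ` at `0`, where the
kernel jumps, does no harm. -/
lemma tendsto_riemannSum {φ : ℝ → ℝ} {C : ℝ} (hφ : ∀ u, |φ u| ≤ C * (1 + u ^ 2)⁻¹)
    (hc : ∀ u, u ≠ 0 → ContinuousAt φ u) :
    Tendsto (fun n : ℕ => (1 / n : ℝ) * ∑' x : ℤ, φ ((x : ℝ) / n)) atTop (𝓝 (∫ u, φ u)) := by
  have hC : 0 ≤ C := by
    have := (abs_nonneg _).trans (hφ 0)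
    simpa using this
  have h : Tendsto (fun n : ℕ => ∫ u : ℝ, φ ((⌊n * u⌋ : ℝ) / n)) atTop (𝓝 (∫ u, φ u)) := by
    refine tendsto_integral_filter_of_dominated_convergence (fun u => 3 * C * (1 + u ^ 2)⁻¹)
      ?_ ?_ (integrable_inv_one_add_sq.const_mul _) ?_
    · filter_upwards [eventually_ne_atTop 0] with n hn
      exact (integrable_comp_floor_of_le hφ hn).aestronglyMeasurable
    · filter_upwards [eventually_ne_atTop 0] with n hn
      refine Eventually.of_forall fun u => (hφ _).trans ?_
      calc C * _ ≤ C * (3 * (1 + u ^ 2)⁻¹) :=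
            mul_le_mul_of_nonneg_left (inv_one_add_floor_sq_le hn u) hC
        _ = _ := by ring
    · have : ∀ᵐ u : ℝ, u ≠ 0 := by simp [ae_iff]
      filter_upwards [this] with u hu
      exact (hc u hu).tendsto.comp (tendsto_floor_mul_div u)
  refine h.congr' ?_
  filter_upwards [eventually_ne_atTop 0] with n hn
  rw [← (hasSum_comp_floor hφ hn).tsum_eq, tsum_mul_left]

end RiemannSums

/-! ### Tightness and convergence of laws on a Hilbert space -/

section Tightness

/-- Intersecting closed thickenings of radii `1/(j+1)`, with exceptional masses summing to less than
`ε`, gives a closed totally bounded set, which is compact by completeness. -/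
lemma isTightMeasureSet_of_forall_thickening {E : Type*} [PseudoMetricSpace E] [CompleteSpace E]
    [MeasurableSpace E] {S : Set (Measure E)}
    (h : ∀ ε : ENNReal, 0 < ε → ∀ δ : ℝ, 0 < δ → ∃ K : Set E, TotallyBounded K ∧
      ∀ μ ∈ S, μ (Metric.cthickening δ K)ᶜ ≤ ε) : IsTightMeasureSet S := by
  rw [isTightMeasureSet_iff_exists_isCompact_measure_compl_le]
  intro ε hε
  obtain ⟨e, he0, hesum⟩ := ENNReal.exists_pos_sum_of_countable' hε.ne' ℕ
  have hd : ∀ j : ℕ, (0 : ℝ) < 1 / (j + 1) := fun j => by positivity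
  choose K hK hKS using fun j => h (e j) (he0 j) (1 / ((j : ℝ) + 1)) (hd j)
  refine ⟨⋂ j : ℕ, Metric.cthickening (1 / ((j : ℝ) + 1)) (K j), ?_, fun μ hμ => ?_⟩
  · refine TotallyBounded.isCompact_of_isClosed ?_
      (isClosed_iInter fun j => Metric.isClosed_cthickening)
    rw [Metric.totallyBounded_iff]
    intro r hr
    obtain ⟨j, hj⟩ := exists_nat_one_div_lt (half_pos hr)
    obtain ⟨t, htf, ht⟩ := Metric.totallyBounded_iff.1 (hK j) (r / 2) (half_pos hr)
    refine ⟨t, htf, fun x hx => ?_⟩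
    have hx1 := Set.mem_iInter.1 hx j
    obtain ⟨y, hy, hxy⟩ := Metric.mem_thickening_iff.1
      (Metric.cthickening_subset_thickening' (half_pos hr) hj (K j) hx1)
    obtain ⟨z, hz, hyz⟩ := Set.mem_iUnion₂.1 (ht hy)
    refine Set.mem_iUnion₂.2 ⟨z, hz, ?_⟩
    have := dist_triangle x y z
    rw [Metric.mem_ball] at hyz ⊢
    linarith
  · rw [Set.compl_iInter]
    exact (measure_iUnion_le _).trans ((ENNReal.tsum_le_tsum fun j => hKS j μ hμ).trans hesum.le)

variable {H : Type*} [NormedAddCommGroup H] [InnerProductSpace ℝ H] [CompleteSpace H]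
  [MeasurableSpace H] [BorelSpace H]

/-- A family of measures with uniformly bounded second moments is tight if it is uniformly close
in mean square to finite-dimensional subspaces. -/
lemma isTightMeasureSet_of_finiteDimensional_approx {S : Set (Measure H)} {C : ENNReal}
    (hC : C ≠ ⊤) (hbd : ∀ μ ∈ S, ∫⁻ x, ENNReal.ofReal (‖x‖ ^ 2) ∂μ ≤ C)
    (h : ∀ ε : ENNReal, 0 < ε → ∃ (V : Submodule ℝ H) (_ : FiniteDimensional ℝ V),
      ∀ μ ∈ S, ∫⁻ x, ENNReal.ofReal (‖x - V.starProjection x‖ ^ 2) ∂μ ≤ ε) :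
    IsTightMeasureSet S := by
  refine isTightMeasureSet_of_forall_thickening fun ε hε δ hδ => ?_
  have hε2 : 0 < ε / 2 := ENNReal.half_pos hε.ne'
  have hδ2 : ENNReal.ofReal (δ ^ 2) ≠ 0 := by simpa using hδ.ne'
  -- The factor `δ²` is the one lost in Chebyshev's inequality at level `δ`.
  obtain ⟨V, hV, hVS⟩ := h (ε / 2 * ENNReal.ofReal (δ ^ 2)) (ENNReal.mul_pos hε2.ne' hδ2)
  obtain ⟨R, hR0, hR⟩ : ∃ R : ℝ, 0 < R ∧ C / ENNReal.ofReal (R ^ 2) ≤ ε / 2 := by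
    rcases eq_or_ne ε ⊤ with rfl | hεt
    · exact ⟨1, one_pos, by simp [ENNReal.top_div_of_ne_top]⟩
    have hq : C / (ε / 2) ≠ ⊤ := ENNReal.div_ne_top hC hε2.ne'
    -- With `q = C / (ε / 2)`, the choice `R = q + 1` ensures `R² ≥ q`.
    refine ⟨(C / (ε / 2)).toReal + 1, by positivity, ?_⟩
    rw [ENNReal.div_le_iff (by simp; positivity) ENNReal.ofReal_ne_top, mul_comm,
      ← ENNReal.div_le_iff hε2.ne' (by finiteness)]
    rw [← ENNReal.ofReal_toReal hq]
    refine ENNReal.ofReal_le_ofReal ?_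
    rw [ENNReal.toReal_ofReal ENNReal.toReal_nonneg]
    nlinarith [ENNReal.toReal_nonneg (a := C / (ε / 2))]
  refine ⟨(Subtype.val : V → H) '' Metric.closedBall 0 R,
    ((isCompact_closedBall (0 : V) R).image continuous_subtype_val).totallyBounded,
    fun μ hμ => ?_⟩
  -- If `x` has norm at most `R` and lies within `δ` of its projection, that projection belongs to
  -- the ball of radius `R` in `V`.
  have hsub : (Metric.cthickening δ ((Subtype.val : V → H) '' Metric.closedBall 0 R))ᶜ ⊆
      {x | ENNReal.ofReal (R ^ 2) ≤ ENNReal.ofReal (‖x‖ ^ 2)} ∪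
      {x | ENNReal.ofReal (δ ^ 2) ≤ ENNReal.ofReal (‖x - V.starProjection x‖ ^ 2)} := by
    intro x hx
    by_contra hcon
    simp only [Set.mem_union, Set.mem_ofPred_eq, not_or, not_le] at hcon
    obtain ⟨h1, h2⟩ := hcon
    have h1' : ‖x‖ ≤ R := by
      by_contra hh
      exact absurd (ENNReal.ofReal_le_ofReal (by have := hR0.le; gcongr; exact (not_le.1 hh).le))
        (not_le.2 h1)
    have h2' : ‖x - V.starProjection x‖ ≤ δ := by
      by_contra hh
      exact absurd (ENNReal.ofReal_le_ofReal (by have := hδ.le; gcongr; exact (not_le.1 hh).le))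
        (not_le.2 h2)
    refine hx (Metric.mem_cthickening_of_dist_le x (V.starProjection x) δ _ ?_
      (by rwa [dist_eq_norm]))
    refine ⟨⟨V.starProjection x, V.starProjection_apply_mem x⟩, ?_, rfl⟩
    rw [mem_closedBall_zero_iff]
    exact (V.norm_starProjection_apply_le x).trans h1'
  refine (measure_mono hsub).trans ((measure_union_le _ _).trans ?_)
  rw [← ENNReal.add_halves ε]
  refine add_le_add ?_ ?_
  · exact (meas_ge_le_lintegral_div (by fun_prop) (by simp; positivity)
      ENNReal.ofReal_ne_top).trans ((ENNReal.div_le_div_right (hbd μ hμ) _).trans hR)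
  · have hm : Measurable fun x : H => ‖x - V.starProjection x‖ ^ 2 :=
      Continuous.measurable (by fun_prop)
    refine (meas_ge_le_lintegral_div hm.ennreal_ofReal.aemeasurable hδ2 ENNReal.ofReal_ne_top).trans ?_
    rw [ENNReal.div_le_iff hδ2 ENNReal.ofReal_ne_top]
    exact hVS μ hμ

/-- A tight sequence of laws on a separable Hilbert space whose characteristic functions converge
pointwise converges weakly. -/
lemma exists_tendsto_of_isTightMeasureSet_of_charFun [SecondCountableTopology H]
    {μ : ℕ → ProbabilityMeasure H} (ht : IsTightMeasureSet {(μ n : Measure H) | n})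
    {φ : H → ℂ} (hφ : ∀ h, Tendsto (fun n => charFun (μ n : Measure H) h) atTop (𝓝 (φ h))) :
    ∃ ν : ProbabilityMeasure H, (∀ h, charFun (ν : Measure H) h = φ h) ∧
      Tendsto μ atTop (𝓝 ν) := by
  have hcpt : IsCompact (closure (Set.range μ)) :=
    isCompact_closure_of_isTightMeasureSet (by simpa using ht)
  -- Prokhorov compactness gives a limit along an ultrafilter; testing against bounded characters
  -- identifies its characteristic function as `φ`.
  let U : Ultrafilter ℕ := Ultrafilter.of atTop
  have hU : (U : Filter ℕ) ≤ atTop := Ultrafilter.of_le _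
  obtain ⟨ν, -, hν : Tendsto μ U (𝓝 ν)⟩ := hcpt.ultrafilter_le_nhds (U.map μ)
    (le_trans (by simp) (principal_mono.2 subset_closure))
  have hchar : ∀ h, charFun (ν : Measure H) h = φ h := fun h => by
    refine tendsto_nhds_unique ?_ ((hφ h).mono_left hU)
    rw [ProbabilityMeasure.tendsto_iff_forall_integral_rclike_tendsto ℂ] at hν
    simp_rw [charFun_eq_integral_innerProbChar]
    exact hν (BoundedContinuousFunction.innerProbChar h)
  refine ⟨ν, hchar, ?_⟩
  -- The whole sequence converges: it is tight, and integrals converge on the point-separating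
  -- algebra of trigonometric polynomials.
  refine ProbabilityMeasure.tendsto_of_tight_of_separatesPoints ht (𝕜 := ℂ)
    (A := BoundedContinuousFunction.charPoly Real.continuous_probChar
      (L := innerₗ H) continuous_inner) ?_ ?_
  · refine BoundedContinuousFunction.separatesPoints_charPoly
      Real.continuous_probChar Real.probChar_ne_one _ ?_
    exact fun v hv => DFunLike.ne_iff.mpr ⟨v, inner_self_ne_zero.mpr hv⟩
  · exact fun g => ProbabilityMeasure.tendsto_charPoly_of_tendsto_charFun
      (by simpa only [hchar] using hφ)

end Tightness

/-! ### Representation of point evaluations in `L²(ℝ)` -/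

section Kernel

/-- The Hilbert space in which the fluctuation fields are realised. -/
abbrev KernelSpace : Type := Lp ℝ 2 (volume : Measure ℝ)

lemma measurable_inv_weight : Measurable fun v : ℝ => ((1 + v ^ 2) ^ 2)⁻¹ := by fun_prop

lemma inv_weight_sq_le (v : ℝ) : (((1 + v ^ 2) ^ 2)⁻¹) ^ 2 ≤ (1 + v ^ 2)⁻¹ := by
  rw [← inv_pow, ← pow_mul]
  have h0 : 0 ≤ (1 + v ^ 2)⁻¹ := by positivity
  have h1 : (1 + v ^ 2)⁻¹ ≤ 1 := inv_le_one_of_one_le₀ (by nlinarith [sq_nonneg v])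
  simpa using pow_le_pow_of_le_one h0 h1 (show 1 ≤ 2 * 2 by norm_num)

lemma memLp_inv_weight : MemLp (fun v : ℝ => ((1 + v ^ 2) ^ 2)⁻¹) 2 (volume : Measure ℝ) := by
  rw [memLp_two_iff_integrable_sq measurable_inv_weight.aestronglyMeasurable]
  exact Integrable.mono' integrable_inv_one_add_sq
    (measurable_inv_weight.pow_const 2).aestronglyMeasurable
    (Eventually.of_forall fun v => by
      rw [Real.norm_eq_abs, abs_of_nonneg (sq_nonneg _)]; exact inv_weight_sq_le v)

/-- The function `(1 + v²)⁻² 1_A(v)` as an element of `L²(ℝ)`. -/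
def weightedIndicator (A : Set ℝ) (hA : MeasurableSet A) : KernelSpace :=
  (memLp_inv_weight.indicator hA).toLp _

lemma coeFn_weightedIndicator (A : Set ℝ) (hA : MeasurableSet A) :
    weightedIndicator A hA =ᵐ[volume] A.indicator fun v : ℝ => ((1 + v ^ 2) ^ 2)⁻¹ :=
  MemLp.coeFn_toLp _

lemma norm_toLp_sq {f : ℝ → ℝ} (hf : MemLp f 2 (volume : Measure ℝ)) :
    ‖hf.toLp f‖ ^ 2 = ∫ v, f v ^ 2 := by
  rw [← real_inner_self_eq_norm_sq, L2.inner_def]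
  refine integral_congr_ae ?_
  filter_upwards [hf.coeFn_toLp] with v hv
  rw [hv, real_inner_self_eq_norm_sq, Real.norm_eq_abs, sq_abs]

/-- The squared weight is `(1 + v²)⁻⁴`. On `A` two factors are bounded by their value at `u`, one by
`1`, and the last integrates to `π ≤ 4`. -/
lemma norm_weightedIndicator_le {A : Set ℝ} (hA : MeasurableSet A) {u : ℝ}
    (hu : ∀ v ∈ A, |u| ≤ |v|) : ‖weightedIndicator A hA‖ ≤ 2 * (1 + u ^ 2)⁻¹ := by
  refine abs_le_of_sq_le_sq' ?_ (by positivity) |>.2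
  rw [weightedIndicator, norm_toLp_sq]
  have hb : ∀ v, (A.indicator (fun v : ℝ => ((1 + v ^ 2) ^ 2)⁻¹) v) ^ 2
      ≤ ((1 + u ^ 2)⁻¹) ^ 2 * (1 + v ^ 2)⁻¹ := fun v => by
    by_cases hv : v ∈ A
    · rw [Set.indicator_of_mem hv]
      have h1 : u ^ 2 ≤ v ^ 2 := sq_le_sq.2 (hu v hv)
      have h2 : (1 + v ^ 2)⁻¹ ≤ (1 + u ^ 2)⁻¹ := inv_anti₀ (by positivity) (by linarith)
      have h3 : (1 + v ^ 2)⁻¹ ≤ 1 := inv_le_one_of_one_le₀ (by nlinarith [sq_nonneg v])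
      have h0 : 0 ≤ (1 + v ^ 2)⁻¹ := by positivity
      calc (((1 + v ^ 2) ^ 2)⁻¹) ^ 2 = ((1 + v ^ 2)⁻¹) ^ 2 * ((1 + v ^ 2)⁻¹) ^ 2 := by
            rw [← inv_pow]; ring
        _ ≤ ((1 + u ^ 2)⁻¹) ^ 2 * (1 + v ^ 2)⁻¹ := by
            gcongr
            nlinarith
    · rw [Set.indicator_of_notMem hv, zero_pow two_ne_zero]; positivity
  have hi : Integrable (fun v : ℝ => ((1 + u ^ 2)⁻¹) ^ 2 * (1 + v ^ 2)⁻¹) :=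
    integrable_inv_one_add_sq.const_mul _
  calc _ ≤ ∫ v : ℝ, ((1 + u ^ 2)⁻¹) ^ 2 * (1 + v ^ 2)⁻¹ :=
        integral_mono_of_nonneg (Eventually.of_forall fun v => sq_nonneg _) hi
          (Eventually.of_forall hb)
    _ = ((1 + u ^ 2)⁻¹) ^ 2 * Real.pi := by
        rw [integral_const_mul, integral_univ_inv_one_add_sq]
    _ ≤ ((1 + u ^ 2)⁻¹) ^ 2 * 4 := by
        gcongr
        exact Real.pi_le_four
    _ = _ := by ring

/-- If the indicators of a family of sets vary continuously almost everywhere, the weighted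
indicators are continuous in `L²(ℝ)`. -/
lemma continuous_weightedIndicator {A : ℝ → Set ℝ} (hA : ∀ u, MeasurableSet (A u))
    (hc : ∀ u v, v ≠ u → ∀ᶠ u' in 𝓝 u, (v ∈ A u' ↔ v ∈ A u)) :
    Continuous fun u => weightedIndicator (A u) (hA u) := by
  rw [continuous_iff_continuousAt]
  intro u
  rw [ContinuousAt, tendsto_iff_norm_sub_tendsto_zero]
  have h : Tendsto (fun u' => ‖weightedIndicator (A u') (hA u') - weightedIndicator (A u) (hA u)‖ ^ 2)
      (𝓝 u) (𝓝 (∫ _ : ℝ, (0 : ℝ))) := by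
    have e : ∀ u', ‖weightedIndicator (A u') (hA u') - weightedIndicator (A u) (hA u)‖ ^ 2
        = ∫ v, ((A u').indicator (fun v : ℝ => ((1 + v ^ 2) ^ 2)⁻¹) v
          - (A u).indicator (fun v : ℝ => ((1 + v ^ 2) ^ 2)⁻¹) v) ^ 2 := fun u' => by
      rw [weightedIndicator, weightedIndicator, ← MemLp.toLp_sub, norm_toLp_sq]
      rfl
    simp_rw [e]
    refine tendsto_integral_filter_of_dominated_convergence (fun v => (1 + v ^ 2)⁻¹)
      (Eventually.of_forall fun u' => ?_) (Eventually.of_forall fun u' =>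
        Eventually.of_forall fun v => ?_) integrable_inv_one_add_sq ?_
    · exact (((measurable_inv_weight.indicator (hA u')).sub
        (measurable_inv_weight.indicator (hA u))).pow_const 2).aestronglyMeasurable
    · rw [Real.norm_eq_abs, abs_of_nonneg (sq_nonneg _)]
      have := inv_weight_sq_le v
      by_cases h1 : v ∈ A u' <;> by_cases h2 : v ∈ A u <;> simp [h1, h2] <;>
        first | positivity | simpa using this
    · have : ∀ᵐ v : ℝ, v ≠ u := by simp [ae_iff]
      filter_upwards [this] with v hv
      refine tendsto_const_nhds.congr' ?_
      filter_upwards [hc u v hv] with u' hu'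
      by_cases h2 : v ∈ A u
      · rw [Set.indicator_of_mem h2, Set.indicator_of_mem (hu'.2 h2)]; simp
      · rw [Set.indicator_of_notMem h2, Set.indicator_of_notMem (fun h => h2 (hu'.1 h))]; simp
  rw [integral_zero] at h
  have := h.sqrt
  simpa [Real.sqrt_sq] using this

/-- The weighted indicator of `(-∞, u]`. -/
def leftKernel (u : ℝ) : KernelSpace := weightedIndicator (Set.Iic u) measurableSet_Iic

/-- The weighted indicator of `(u, ∞)`. -/
def rightKernel (u : ℝ) : KernelSpace := weightedIndicator (Set.Ioi u) measurableSet_Ioi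

lemma eventually_lt_iff_lt {u v : ℝ} (hvu : v ≠ u) : ∀ᶠ u' in 𝓝 u, (u' < v ↔ u < v) := by
  rcases lt_or_gt_of_ne hvu with h | h
  · filter_upwards [lt_mem_nhds h] with u' hu'
    exact iff_of_false hu'.not_gt h.not_gt
  · filter_upwards [gt_mem_nhds h] with u' hu'
    exact iff_of_true hu' h

lemma continuous_leftKernel : Continuous leftKernel :=
  continuous_weightedIndicator _ fun u v hvu => by
    filter_upwards [eventually_lt_iff_lt hvu] with u' hu'
    rw [Set.mem_Iic, Set.mem_Iic, ← not_lt, ← not_lt]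
    exact not_congr hu'

lemma continuous_rightKernel : Continuous rightKernel :=
  continuous_weightedIndicator _ fun _ _ hvu => eventually_lt_iff_lt hvu

/-- The vector of `L²(ℝ)` that represents the evaluation of test functions at `u`. -/
def kernel (u : ℝ) : KernelSpace := if 0 < u then -rightKernel u else leftKernel u

/-- The half-line chosen for `u` points away from the origin, so `|v| ≥ |u|` on it. -/
lemma norm_kernel_le (u : ℝ) : ‖kernel u‖ ≤ 2 * (1 + u ^ 2)⁻¹ := by
  unfold kernel
  split_ifs with h
  · rw [norm_neg]
    refine norm_weightedIndicator_le _ fun v hv => ?_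
    rw [Set.mem_Ioi] at hv
    rw [abs_of_pos h, abs_of_pos (h.trans hv)]; exact hv.le
  · refine norm_weightedIndicator_le _ fun v hv => ?_
    rw [Set.mem_Iic] at hv
    rw [abs_of_nonpos (not_lt.1 h), abs_of_nonpos (hv.trans (not_lt.1 h))]; linarith

lemma continuousAt_kernel {u : ℝ} (hu : u ≠ 0) : ContinuousAt kernel u := by
  rcases lt_or_gt_of_ne hu with h | h
  · refine continuous_leftKernel.continuousAt.congr ?_
    filter_upwards [gt_mem_nhds h] with v hv
    simp [kernel, (hv : v < 0).le]
  · refine continuous_rightKernel.neg.continuousAt.congr ?_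
    filter_upwards [lt_mem_nhds h] with v hv
    simp [kernel, (hv : 0 < v)]

/-- The kernel jumps at `0`, but its values lie on two continuous curves, each with compact image
over the interval. -/
lemma totallyBounded_kernel_image (R : ℝ) : TotallyBounded (kernel '' Set.Icc (-R) R) := by
  have h : TotallyBounded ((fun u => -rightKernel u) '' Set.Icc (-R) R ∪
      leftKernel '' Set.Icc (-R) R) :=
    ((isCompact_Icc.image continuous_rightKernel.neg).union
      (isCompact_Icc.image continuous_leftKernel)).totallyBounded
  refine h.subset ?_
  rintro _ ⟨u, hu, rfl⟩
  by_cases h : 0 < u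
  · exact Or.inl ⟨u, hu, by simp [kernel, h]⟩
  · exact Or.inr ⟨u, hu, by simp [kernel, h]⟩

/-- The kernel is approximated by finite-dimensional subspaces, with an integrable weight. -/
lemma exists_finiteDimensional_kernel_approx {ε : ℝ} (hε : 0 < ε) :
    ∃ (V : Submodule ℝ KernelSpace) (_ : FiniteDimensional ℝ V), ∀ u : ℝ,
      ‖kernel u - V.starProjection (kernel u)‖ ^ 2 ≤ ε * (1 + u ^ 2)⁻¹ := by
  -- This makes `4 / ε ≤ 1 + u²` once `|u| ≥ R`, so that `(2(1 + u²)⁻¹)² ≤ ε(1 + u²)⁻¹`: outside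
  -- `[-R, R]` approximation by `0` is good enough. Inside, `V` is spanned by a finite net of mesh
  -- `√(ε / (1 + R²))`.
  set R : ℝ := 4 / ε + 1
  have hR : 0 < R := by positivity
  obtain ⟨t, htf, ht⟩ := Metric.totallyBounded_iff.1 (totallyBounded_kernel_image R)
    (√(ε / (1 + R ^ 2))) (by positivity)
  refine ⟨Submodule.span ℝ t, FiniteDimensional.span_of_finite ℝ htf, fun u => ?_⟩
  have := FiniteDimensional.span_of_finite ℝ htf
  have hle : ∀ y ∈ Submodule.span ℝ t,
      ‖kernel u - (Submodule.span ℝ t).starProjection (kernel u)‖ ≤ ‖kernel u - y‖ := fun y hy => by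
    rw [Submodule.starProjection_minimal]
    exact ciInf_le ⟨0, by rintro _ ⟨z, rfl⟩; exact norm_nonneg _⟩ (⟨y, hy⟩ : Submodule.span ℝ t)
  by_cases hu : u ∈ Set.Icc (-R) R
  · obtain ⟨y, hy, hyu⟩ := Set.mem_iUnion₂.1 (ht ⟨u, hu, rfl⟩)
    have h1 := (hle y (Submodule.subset_span hy)).trans (by
      rw [← dist_eq_norm]; exact (Metric.mem_ball.1 hyu).le : _ ≤ √(ε / (1 + R ^ 2)))
    have h2 : u ^ 2 ≤ R ^ 2 := sq_le_sq' hu.1 hu.2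
    calc _ ≤ (√(ε / (1 + R ^ 2))) ^ 2 := by gcongr
      _ = ε * (1 + R ^ 2)⁻¹ := by rw [Real.sq_sqrt (by positivity), div_eq_mul_inv]
      _ ≤ _ := by gcongr
  · have h1 := (hle 0 (Submodule.zero_mem _)).trans (by rw [sub_zero]; exact norm_kernel_le u : _ ≤ 2 * (1 + u ^ 2)⁻¹)
    have hu' : R ≤ |u| := by
      by_contra hh
      exact hu (abs_le.1 (not_le.1 hh).le)
    have h2 : 4 / ε ≤ 1 + u ^ 2 := by
      rw [← sq_abs]
      have : 0 < 4 / ε := by positivity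
      nlinarith
    have h3 : (1 + u ^ 2)⁻¹ ≤ ε / 4 := by
      rw [← inv_div]; gcongr
    have h0 : 0 ≤ (1 + u ^ 2)⁻¹ := by positivity
    calc _ ≤ (2 * (1 + u ^ 2)⁻¹) ^ 2 := by gcongr
      _ ≤ _ := by nlinarith

end Kernel

/-! ### Embedding of test functions into `L²(ℝ)` -/

section Embedding

variable {α : ℝ}

lemma TestSpace.hasDerivAt (f : TestSpace α) {u : ℝ} (hu : u ≠ 0) :
    HasDerivAt f (deriv f u) u :=
  ((f.isTestFunction.contDiffAt 1 hu).differentiableAt (by norm_num)).hasDerivAt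

/-- The power `6` covers the weight of degree `4` and leaves a spare integrable factor `(1 + v²)⁻¹`;
the `4` comes from `(1 + s)³ ≤ 4(1 + s³)` with `s = v²`. -/
lemma TestSpace.abs_weight_mul_deriv_le (f : TestSpace α) {v : ℝ} (hv : v ≠ 0) :
    |(1 + v ^ 2) ^ 2 * deriv f v| ≤ 4 * supNorm 1 6 f * (1 + v ^ 2)⁻¹ := by
  have h := le_supNorm 1 6 f hv
  rw [iteratedDeriv_one, abs_mul, abs_of_nonneg (by positivity)] at h
  have h6 : |v| ^ 6 = (v ^ 2) ^ 3 := by rw [← sq_abs]; ring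
  rw [h6] at h
  rw [← div_eq_mul_inv, le_div_iff₀ (by positivity), abs_mul, abs_of_nonneg (by positivity)]
  have h1 : (1 + v ^ 2) ^ 3 ≤ 4 * (1 + (v ^ 2) ^ 3) := by
    nlinarith [mul_nonneg (sq_nonneg (v ^ 2 - 1)) (by positivity : 0 ≤ 1 + v ^ 2)]
  calc _ = (1 + v ^ 2) ^ 3 * |deriv f v| := by ring
    _ ≤ 4 * (1 + (v ^ 2) ^ 3) * |deriv f v| := by gcongr
    _ ≤ _ := by linarith

lemma ae_ne_zero : ∀ᵐ v : ℝ, v ≠ 0 := by simp [ae_iff]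

lemma TestSpace.sq_weight_mul_deriv_le (f : TestSpace α) {v : ℝ} (hv : v ≠ 0) :
    ((1 + v ^ 2) ^ 2 * deriv f v) ^ 2 ≤ (4 * supNorm 1 6 f) ^ 2 * (1 + v ^ 2)⁻¹ := by
  have h := f.abs_weight_mul_deriv_le hv
  have h0 : 0 ≤ (1 + v ^ 2)⁻¹ := by positivity
  have h1 : (1 + v ^ 2)⁻¹ ≤ 1 := inv_le_one_of_one_le₀ (by nlinarith [sq_nonneg v])
  rw [← sq_abs]
  calc _ ≤ (4 * supNorm 1 6 f * (1 + v ^ 2)⁻¹) ^ 2 := by gcongr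
    _ = (4 * supNorm 1 6 f) ^ 2 * ((1 + v ^ 2)⁻¹) ^ 2 := by ring
    _ ≤ _ := by
      gcongr
      nlinarith

lemma TestSpace.memLp_weight_mul_deriv (f : TestSpace α) :
    MemLp (fun v => (1 + v ^ 2) ^ 2 * deriv f v) 2 (volume : Measure ℝ) := by
  have hm : Measurable fun v => (1 + v ^ 2) ^ 2 * deriv f v :=
    (by fun_prop : Measurable fun v : ℝ => (1 + v ^ 2) ^ 2).mul (measurable_deriv f)
  rw [memLp_two_iff_integrable_sq hm.aestronglyMeasurable]
  refine Integrable.mono' (integrable_inv_one_add_sq.const_mul ((4 * supNorm 1 6 f) ^ 2))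
    (hm.pow_const 2).aestronglyMeasurable ?_
  filter_upwards [ae_ne_zero] with v hv
  rw [Real.norm_eq_abs, abs_of_nonneg (sq_nonneg _)]
  exact f.sq_weight_mul_deriv_le hv

/-- The linear map `f ↦ (1 + v²)² f'` from test functions to `L²(ℝ)`. -/
def weightedDerivLinear (α : ℝ) : TestSpace α →ₗ[ℝ] KernelSpace where
  toFun f := f.memLp_weight_mul_deriv.toLp _
  map_add' f g := by
    rw [← MemLp.toLp_add]
    refine MemLp.toLp_congr _ _ ?_
    filter_upwards [ae_ne_zero] with v hv
    have : deriv (f + g : TestSpace α) v = deriv f v + deriv g v :=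
      ((f.hasDerivAt hv).add (g.hasDerivAt hv)).deriv
    simp only [this, Pi.add_apply]
    ring
  map_smul' c f := by
    rw [RingHom.id_apply, ← MemLp.toLp_const_smul]
    refine MemLp.toLp_congr _ _ ?_
    filter_upwards [ae_ne_zero] with v hv
    have : deriv (c • f : TestSpace α) v = c * deriv f v :=
      ((f.hasDerivAt hv).const_mul c).deriv
    simp only [this, Pi.smul_apply, smul_eq_mul]
    ring

lemma norm_weightedDerivLinear_le (f : TestSpace α) :
    ‖weightedDerivLinear α f‖ ≤ 8 * TestSpace.supNorm 1 6 f := by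
  have hs : 0 ≤ TestSpace.supNorm 1 6 f := Real.iSup_nonneg fun _ => abs_nonneg _
  refine abs_le_of_sq_le_sq' ?_ (by positivity) |>.2
  change ‖f.memLp_weight_mul_deriv.toLp _‖ ^ 2 ≤ _
  rw [norm_toLp_sq]
  calc _ ≤ ∫ v : ℝ, (4 * TestSpace.supNorm 1 6 f) ^ 2 * (1 + v ^ 2)⁻¹ := by
        refine integral_mono_of_nonneg (Eventually.of_forall fun v => sq_nonneg _)
          (integrable_inv_one_add_sq.const_mul _) ?_
        filter_upwards [ae_ne_zero] with v hv using f.sq_weight_mul_deriv_le hv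
    _ = (4 * TestSpace.supNorm 1 6 f) ^ 2 * Real.pi := by
        rw [integral_const_mul, integral_univ_inv_one_add_sq]
    _ ≤ (4 * TestSpace.supNorm 1 6 f) ^ 2 * 4 := by
        gcongr
        exact Real.pi_le_four
    _ = _ := by ring

/-- The continuous linear map `f ↦ (1 + v²)² f'` from test functions to `L²(ℝ)`. -/
def weightedDeriv (α : ℝ) : TestSpace α →L[ℝ] KernelSpace :=
  ⟨weightedDerivLinear α, by
    refine WithSeminorms.continuous_normedSpace_rng KernelSpace (TestSpace.withSeminorms α)
      (weightedDerivLinear α) ⟨{(1, 6)}, 8, fun f => ?_⟩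
    rw [Finset.sup_singleton]
    exact norm_weightedDerivLinear_le f⟩

lemma coeFn_weightedDeriv (f : TestSpace α) :
    weightedDeriv α f =ᵐ[volume] fun v => (1 + v ^ 2) ^ 2 * deriv f v :=
  MemLp.coeFn_toLp f.memLp_weight_mul_deriv

lemma TestSpace.integrable_deriv (f : TestSpace α) : Integrable (deriv f) := by
  refine Integrable.mono' (integrable_inv_one_add_sq.const_mul (4 * supNorm 1 6 f))
    (measurable_deriv f).aestronglyMeasurable ?_
  filter_upwards [ae_ne_zero] with v hv
  refine le_trans ?_ (f.abs_weight_mul_deriv_le hv)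
  rw [Real.norm_eq_abs, abs_mul, abs_of_nonneg (by positivity : 0 ≤ (1 + v ^ 2) ^ 2)]
  exact le_mul_of_one_le_left (abs_nonneg _) (one_le_pow₀ (by nlinarith [sq_nonneg v]))

lemma inner_weightedIndicator_weightedDeriv {A : Set ℝ} (hA : MeasurableSet A) (f : TestSpace α) :
    inner ℝ (weightedIndicator A hA) (weightedDeriv α f) = ∫ v in A, deriv f v := by
  rw [L2.inner_def, ← integral_indicator hA]
  refine integral_congr_ae ?_
  filter_upwards [coeFn_weightedIndicator A hA, coeFn_weightedDeriv f] with v h1 h2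
  rw [h1, h2]
  by_cases hv : v ∈ A
  · simp only [Set.indicator_of_mem hv, RCLike.inner_apply, conj_trivial]
    field_simp
  · simp [Set.indicator_of_notMem hv]

lemma TestSpace.tendsto_cocompact_zero (f : TestSpace α) :
    Tendsto f (cocompact ℝ) (𝓝 0) := by
  have h : Tendsto (fun u : ℝ => supNorm 0 2 f * (1 + u ^ 2)⁻¹) (cocompact ℝ)
      (𝓝 (supNorm 0 2 f * 0)) := by
    refine Tendsto.const_mul _ (tendsto_inv_atTop_zero.comp
      (tendsto_atTop_add_const_left _ _ ?_))
    have := (tendsto_pow_atTop (α := ℝ) two_ne_zero).comp (tendsto_norm_cocompact_atTop (E := ℝ))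
    exact this.congr fun u => by simp
  rw [mul_zero] at h
  exact squeeze_zero_norm f.abs_le h

/-- Point evaluations of test functions are represented by the kernel. -/
lemma inner_kernel_weightedDeriv (f : TestSpace α) (u : ℝ) :
    inner ℝ (kernel u) (weightedDeriv α f) = f u := by
  unfold kernel
  split_ifs with h
  · rw [inner_neg_left, rightKernel, inner_weightedIndicator_weightedDeriv,
      integral_Ioi_of_hasDerivAt_of_tendsto' (m := 0)
        (fun x hx => f.hasDerivAt (h.trans_le hx).ne') f.integrable_deriv.integrableOn
        (f.tendsto_cocompact_zero.mono_left
          atTop_le_cocompact)]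
    simp
  · rw [leftKernel, inner_weightedIndicator_weightedDeriv,
      integral_Iic_of_hasDerivAt_of_tendsto (m := 0) ?_
        (fun x hx => f.hasDerivAt (hx.trans_le (not_lt.1 h)).ne) f.integrable_deriv.integrableOn
        (f.tendsto_cocompact_zero.mono_left
          atBot_le_cocompact)]
    · simp
    · rcases (not_lt.1 h).eq_or_lt with rfl | hu
      -- At `u = 0` the fundamental theorem on `(-∞, 0]` needs continuity from the left only.
      · exact f.isTestFunction.left_continuous
      · exact (f.hasDerivAt hu.ne).continuousAt.continuousWithinAt

end Embedding

/-! ### The occupation variables under the slowly varying Bernoulli measure -/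

section Occupation

variable (ρ₀ : ℝ → unitInterval) (n : ℕ)

lemma measurable_occ (x : ℤ) : Measurable fun η : Config => occ η x :=
  (measurable_of_countable fun b : Bool => if b then (1 : ℝ) else 0).comp (measurable_pi_apply x)

lemma measurable_occ_sub_meanOcc (μ : Measure Config) (x : ℤ) :
    Measurable fun η : Config => occ η x - meanOcc μ x :=
  (measurable_occ x).sub_const _

lemma integral_comp_eval_slowlyVaryingBernoulli (g : Bool → ℝ) (x : ℤ) :
    ∫ η, g (η x) ∂slowlyVaryingBernoulli ρ₀ n
      = (ρ₀ (x / n) : ℝ) * g true + (1 - (ρ₀ (x / n) : ℝ)) * g false := by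
  have h := Measure.infinitePi_map_eval
    (fun x : ℤ => bernoulliMeasure true false (ρ₀ (x / n))) x
  rw [← smul_eq_mul, ← smul_eq_mul, ← integral_bernoulliMeasure, ← h,
    integral_map (measurable_pi_apply x).aemeasurable
      (measurable_of_countable g).aestronglyMeasurable]
  rfl

lemma meanOcc_slowlyVaryingBernoulli (x : ℤ) :
    meanOcc (slowlyVaryingBernoulli ρ₀ n) x = ρ₀ (x / n) := by
  have h := integral_comp_eval_slowlyVaryingBernoulli ρ₀ n (fun b => if b then 1 else 0) x
  simpa [meanOcc, occ] using h

lemma integral_occ_sub_meanOcc (x : ℤ) :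
    ∫ η, (occ η x - meanOcc (slowlyVaryingBernoulli ρ₀ n) x) ∂slowlyVaryingBernoulli ρ₀ n = 0 := by
  rw [meanOcc_slowlyVaryingBernoulli]
  have h := integral_comp_eval_slowlyVaryingBernoulli ρ₀ n
    (fun b => (if b then 1 else 0) - (ρ₀ (x / n) : ℝ)) x
  refine h.trans ?_
  simp
  ring

lemma integral_sq_occ_sub_meanOcc (x : ℤ) :
    ∫ η, (occ η x - meanOcc (slowlyVaryingBernoulli ρ₀ n) x) ^ 2 ∂slowlyVaryingBernoulli ρ₀ n
      = chi (ρ₀ (x / n)) := by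
  rw [meanOcc_slowlyVaryingBernoulli]
  have h := integral_comp_eval_slowlyVaryingBernoulli ρ₀ n
    (fun b => ((if b then 1 else 0) - (ρ₀ (x / n) : ℝ)) ^ 2) x
  refine h.trans ?_
  simp [chi]
  ring

lemma iIndepFun_occ_sub_meanOcc :
    iIndepFun (fun (x : ℤ) (η : Config) => occ η x - meanOcc (slowlyVaryingBernoulli ρ₀ n) x)
      (slowlyVaryingBernoulli ρ₀ n) :=
  iIndepFun_infinitePi (P := fun x : ℤ => bernoulliMeasure true false (ρ₀ (x / n)))
    (X := fun x b => (if b then (1 : ℝ) else 0) - meanOcc (slowlyVaryingBernoulli ρ₀ n) x)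
    fun _ => measurable_of_countable _

end Occupation

/-! ### The fluctuation field in `L²(ℝ)` -/

section KernelField

instance : MeasurableSpace KernelSpace := borel _

instance : BorelSpace KernelSpace := ⟨rfl⟩

instance : SecondCountableTopology KernelSpace :=
  have : Fact ((2 : ENNReal) ≠ ⊤) := ⟨by simp⟩
  inferInstance

/-- The vector `n^{-1/2} K_{x/n}`. -/
def latticeKernel (n : ℕ) (x : ℤ) : KernelSpace := (1 / √(n : ℝ)) • kernel ((x : ℝ) / n)

/-- The fluctuation field `n^{-1/2} ∑_x (η(x) - ρ^n_0(x)) K_{x/n}` in `L²(ℝ)`. -/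
def kernelField (n : ℕ) (μ : Measure Config) (η : Config) : KernelSpace :=
  ∑' x : ℤ, (occ η x - meanOcc μ x) • latticeKernel n x

lemma inv_one_add_sq_le_one (u : ℝ) : (1 + u ^ 2)⁻¹ ≤ 1 :=
  inv_le_one_of_one_le₀ (by nlinarith [sq_nonneg u])

lemma norm_kernel_sq_le (u : ℝ) : ‖kernel u‖ ^ 2 ≤ 4 * (1 + u ^ 2)⁻¹ := by
  have h0 : 0 ≤ (1 + u ^ 2)⁻¹ := by positivity
  calc _ ≤ (2 * (1 + u ^ 2)⁻¹) ^ 2 := by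
        have := norm_kernel_le u
        gcongr
    _ ≤ _ := by nlinarith [inv_one_add_sq_le_one u]

lemma summable_norm_latticeKernel (n : ℕ) : Summable fun x : ℤ => ‖latticeKernel n x‖ := by
  rcases eq_or_ne n 0 with rfl | hn
  · simp [latticeKernel]
  · refine Summable.of_nonneg_of_le (fun _ => norm_nonneg _) (fun x => ?_)
      (((summable_weight hn).mul_left 2).mul_left (1 / √(n : ℝ)))
    rw [latticeKernel, norm_smul, Real.norm_eq_abs, abs_of_nonneg (by positivity)]
    gcongr
    exact norm_kernel_le _

lemma norm_inv_sqrt_smul_sq {E : Type*} [NormedAddCommGroup E] [NormedSpace ℝ E] (n : ℕ) (d : E) :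
    ‖(1 / √(n : ℝ)) • d‖ ^ 2 = 1 / n * ‖d‖ ^ 2 := by
  rw [norm_smul, mul_pow, Real.norm_eq_abs, sq_abs, div_pow, one_pow, Real.sq_sqrt (by positivity)]

/-- Squaring `n^{-1/2}` produces Riemann sums, dominated by those of `ε(1 + u²)⁻¹` and hence bounded
uniformly in `n`. This serves both the tightness and the Lyapunov estimates. -/
lemma summable_and_tsum_norm_sq_le {E : Type*} [NormedAddCommGroup E] [NormedSpace ℝ E]
    {d : ℝ → E} {ε : ℝ} (hε : 0 ≤ ε) (hd : ∀ u, ‖d u‖ ^ 2 ≤ ε * (1 + u ^ 2)⁻¹) (n : ℕ) :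
    (Summable fun x : ℤ => ‖(1 / √(n : ℝ)) • d ((x : ℝ) / n)‖ ^ 2) ∧
      ∑' x : ℤ, ‖(1 / √(n : ℝ)) • d ((x : ℝ) / n)‖ ^ 2 ≤ ε * (3 * Real.pi) := by
  simp_rw [norm_inv_sqrt_smul_sq]
  rcases eq_or_ne n 0 with rfl | hn
  -- For `n = 0` the prefactor is `1 / 0 = 0`, so the sum vanishes.
  · simp; positivity
  have hw := summable_weight hn
  have hle : ∀ x : ℤ, 1 / (n : ℝ) * ‖d ((x : ℝ) / n)‖ ^ 2
      ≤ 1 / n * (ε * (1 + ((x : ℝ) / n) ^ 2)⁻¹) := fun x => by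
    gcongr
    exact hd _
  have hs := Summable.of_nonneg_of_le (fun x => by positivity) hle
    ((hw.mul_left ε).mul_left (1 / (n : ℝ)))
  refine ⟨hs, (hs.tsum_le_tsum hle ((hw.mul_left ε).mul_left (1 / (n : ℝ)))).trans ?_⟩
  rw [tsum_mul_left, tsum_mul_left, mul_left_comm]
  exact mul_le_mul_of_nonneg_left (tsum_weight_le hn) hε

lemma measurable_kernelField (n : ℕ) (μ : Measure Config) [IsProbabilityMeasure μ] :
    Measurable (kernelField n μ) :=
  measurable_tsum_smul (fun x => measurable_occ_sub_meanOcc μ x)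
    (fun x η => abs_occ_sub_meanOcc_le μ η x) (summable_norm_latticeKernel n)

/-- Second moments of linear images of the fluctuation field. -/
lemma lintegral_norm_sq_kernelField_le (ρ₀ : ℝ → unitInterval) (n : ℕ)
    (L : KernelSpace →L[ℝ] KernelSpace) {ε : ℝ} (hε : 0 ≤ ε)
    (hL : ∀ u, ‖L (kernel u)‖ ^ 2 ≤ ε * (1 + u ^ 2)⁻¹) :
    ∫⁻ h, ENNReal.ofReal (‖L h‖ ^ 2)
      ∂(slowlyVaryingBernoulli ρ₀ n).map (kernelField n (slowlyVaryingBernoulli ρ₀ n))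
      ≤ ENNReal.ofReal (ε * (3 * Real.pi)) := by
  set μ := slowlyVaryingBernoulli ρ₀ n
  have hb : ∀ (x : ℤ) (η : Config), |occ η x - meanOcc μ x| ≤ 1 :=
    fun x η => abs_occ_sub_meanOcc_le μ η x
  have hc := summable_norm_latticeKernel n
  have hLc : Summable fun x : ℤ => ‖L (latticeKernel n x)‖ :=
    Summable.of_nonneg_of_le (fun _ => norm_nonneg _) (fun x => L.le_opNorm _) (hc.mul_left _)
  have e : ∀ η, L (kernelField n μ η) = ∑' x : ℤ, (occ η x - meanOcc μ x) • L (latticeKernel n x) :=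
    fun η => by
      rw [kernelField, L.map_tsum (summable_smul_of_abs_le_one hb hc η)]
      simp only [map_smul]
  obtain ⟨hs, hle⟩ := summable_and_tsum_norm_sq_le (d := fun u => L (kernel u)) hε hL n
  have e2 : ∀ x : ℤ, L (latticeKernel n x) = (1 / √(n : ℝ)) • L (kernel ((x : ℝ) / n)) :=
    fun x => by rw [latticeKernel, map_smul]
  simp_rw [← e2] at hs hle
  have hm : Measurable fun h : KernelSpace => ‖L h‖ ^ 2 := Continuous.measurable (by fun_prop)
  rw [lintegral_map hm.ennreal_ofReal (measurable_kernelField n μ)]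
  simp_rw [e]
  rw [← ofReal_integral_eq_lintegral_ofReal]
  · exact ENNReal.ofReal_le_ofReal ((integral_norm_sq_tsum_le
      (fun x => measurable_occ_sub_meanOcc μ x) hb (integral_occ_sub_meanOcc ρ₀ n)
      (iIndepFun_occ_sub_meanOcc ρ₀ n) hLc hs).trans hle)
  · refine Integrable.of_bound (C := (∑' x : ℤ, ‖L (latticeKernel n x)‖) ^ 2)
      ((measurable_tsum_smul (fun x => measurable_occ_sub_meanOcc μ x) hb
        hLc).norm.pow_const 2).aestronglyMeasurable (Eventually.of_forall fun η => ?_)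
    rw [norm_pow, norm_norm]
    have := norm_tsum_smul_le hb hLc η
    gcongr
  · exact Eventually.of_forall fun η => by positivity

/-- The law of the fluctuation field in `L²(ℝ)`. -/
def kernelFieldLaw (ρ₀ : ℝ → unitInterval) (n : ℕ) : ProbabilityMeasure KernelSpace :=
  ⟨(slowlyVaryingBernoulli ρ₀ n).map (kernelField n (slowlyVaryingBernoulli ρ₀ n)),
    Measure.isProbabilityMeasure_map (measurable_kernelField n _).aemeasurable⟩

/-- The moment bound is used with `L = id` for bounded second moments, and with `L` the projection
off `V` for the finite-dimensional approximation. -/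
lemma isTightMeasureSet_kernelFieldLaw (ρ₀ : ℝ → unitInterval) :
    IsTightMeasureSet {(kernelFieldLaw ρ₀ n : Measure KernelSpace) | n} := by
  refine isTightMeasureSet_of_finiteDimensional_approx
    (C := ENNReal.ofReal (4 * (3 * Real.pi))) ENNReal.ofReal_ne_top ?_ fun ε hε => ?_
  · rintro _ ⟨n, rfl⟩
    rw [kernelFieldLaw, ProbabilityMeasure.coe_mk]
    simpa only [ContinuousLinearMap.id_apply] using
      lintegral_norm_sq_kernelField_le ρ₀ n (ContinuousLinearMap.id ℝ KernelSpace)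
        (ε := 4) (by norm_num) (fun u => by simpa using norm_kernel_sq_le u)
  · obtain ⟨δ, hδ, hδε⟩ : ∃ δ : ℝ, 0 < δ ∧ ENNReal.ofReal (δ * (3 * Real.pi)) ≤ ε := by
      -- A finite `r` below `ε` is taken because `ε` may be infinite.
      obtain ⟨r, hr, hrε⟩ := ENNReal.lt_iff_exists_nnreal_btwn.1 hε
      have hr' : 0 < r := by exact_mod_cast hr
      refine ⟨r / (3 * Real.pi), by positivity, ?_⟩
      rw [div_mul_cancel₀ _ (by positivity), ENNReal.ofReal_coe_nnreal]
      exact hrε.le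
    obtain ⟨V, hV, hVk⟩ := exists_finiteDimensional_kernel_approx hδ
    refine ⟨V, hV, ?_⟩
    rintro _ ⟨n, rfl⟩
    rw [kernelFieldLaw, ProbabilityMeasure.coe_mk]
    have h := lintegral_norm_sq_kernelField_le ρ₀ n
      (ContinuousLinearMap.id ℝ KernelSpace - V.starProjection) hδ.le
      (fun u => by simpa using hVk u)
    simp only [sub_apply, ContinuousLinearMap.id_apply] at h
    exact h.trans hδε

/-- The covariance form of the limiting field. -/
def covarianceForm (ρ₀ : ℝ → unitInterval) (h : KernelSpace) : ℝ :=
  ∫ u, chi (ρ₀ u) * inner ℝ (kernel u) h ^ 2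

lemma chi_nonneg (p : unitInterval) : 0 ≤ chi p :=
  mul_nonneg p.2.1 (sub_nonneg.2 p.2.2)

lemma chi_le_one (p : unitInterval) : chi p ≤ 1 :=
  mul_le_one₀ p.2.2 (sub_nonneg.2 p.2.2) (by linarith [p.2.1])

lemma abs_chi_mul_inner_kernel_sq_le (ρ₀ : ℝ → unitInterval) (h : KernelSpace) (u : ℝ) :
    |chi (ρ₀ u) * inner ℝ (kernel u) h ^ 2| ≤ 4 * ‖h‖ ^ 2 * (1 + u ^ 2)⁻¹ := by
  rw [abs_of_nonneg (mul_nonneg (chi_nonneg _) (sq_nonneg _))]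
  calc _ ≤ inner ℝ (kernel u) h ^ 2 := mul_le_of_le_one_left (sq_nonneg _) (chi_le_one _)
    _ ≤ (‖kernel u‖ * ‖h‖) ^ 2 := sq_le_sq' (neg_le_of_abs_le (abs_real_inner_le_norm _ _))
        (real_inner_le_norm _ _)
    _ = ‖kernel u‖ ^ 2 * ‖h‖ ^ 2 := mul_pow _ _ _
    _ ≤ 4 * (1 + u ^ 2)⁻¹ * ‖h‖ ^ 2 := by
        gcongr
        exact norm_kernel_sq_le u
    _ = _ := by ring

/-- With `a n x = n^{-1/2} ⟪K_{x/n}, h⟫`, the Lyapunov error is at most `4 max |a| ∑ a² =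
O(n^{-1/2})`, while the variance is a Riemann sum for `covarianceForm ρ₀ h`. -/
lemma tendsto_charFun_kernelFieldLaw {ρ₀ : ℝ → unitInterval}
    (hρ₀ : Continuous fun u => (ρ₀ u : ℝ)) (h : KernelSpace) :
    Tendsto (fun n => charFun (kernelFieldLaw ρ₀ n : Measure KernelSpace) h) atTop
      (𝓝 (Complex.exp (-(covarianceForm ρ₀ h / 2 : ℝ)))) := by
  let a : ℕ → ℤ → ℝ := fun n x => inner ℝ (latticeKernel n x) h
  have ha2 : ∀ n x, a n x ^ 2 = 1 / n * inner ℝ (kernel ((x : ℝ) / n)) h ^ 2 := fun n x => by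
    simp only [a, latticeKernel, real_inner_smul_left, mul_pow, div_pow, one_pow,
      Real.sq_sqrt (Nat.cast_nonneg n)]
  have hamax : ∀ n x, |a n x| ≤ 2 * ‖h‖ / √(n : ℝ) := fun n x => by
    refine (abs_real_inner_le_norm _ _).trans ?_
    rw [latticeKernel, norm_smul, Real.norm_eq_abs, abs_of_nonneg (by positivity)]
    have : ‖kernel ((x : ℝ) / n)‖ ≤ 2 :=
      (norm_kernel_le _).trans (by linarith [inv_one_add_sq_le_one ((x : ℝ) / n)])
    calc _ ≤ 1 / √(n : ℝ) * 2 * ‖h‖ := by gcongr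
      _ = _ := by ring
  have hasum : ∀ n, Summable fun x => |a n x| := fun n =>
    Summable.of_nonneg_of_le (fun _ => abs_nonneg _) (fun x => abs_real_inner_le_norm _ _)
      ((summable_norm_latticeKernel n).mul_right _)
  have hsq : ∀ n, (Summable fun x => |a n x| ^ 2) ∧
      ∑' x, |a n x| ^ 2 ≤ 4 * ‖h‖ ^ 2 * (3 * Real.pi) := fun n => by
    have := summable_and_tsum_norm_sq_le (d := fun u => inner ℝ (kernel u) h)
      (ε := 4 * ‖h‖ ^ 2) (by positivity) (fun u => by
        have h1 := norm_kernel_sq_le u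
        calc _ ≤ (‖kernel u‖ * ‖h‖) ^ 2 := by
              gcongr
              exact norm_inner_le_norm _ _
          _ = ‖kernel u‖ ^ 2 * ‖h‖ ^ 2 := mul_pow _ _ _
          _ ≤ 4 * (1 + u ^ 2)⁻¹ * ‖h‖ ^ 2 := by gcongr
          _ = _ := by ring) n
    simpa only [a, latticeKernel, real_inner_smul_left, smul_eq_mul, Real.norm_eq_abs] using this
  have hchar : ∀ n, charFun (kernelFieldLaw ρ₀ n : Measure KernelSpace) h
      = ∫ η, Complex.exp ((∑' x, a n x * (occ η x
          - meanOcc (slowlyVaryingBernoulli ρ₀ n) x) : ℝ) * Complex.I)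
        ∂slowlyVaryingBernoulli ρ₀ n := fun n => by
    rw [charFun_apply, kernelFieldLaw, ProbabilityMeasure.coe_mk,
      integral_map (measurable_kernelField n _).aemeasurable
        (Continuous.aestronglyMeasurable (by fun_prop))]
    congr 1
    ext η
    have hs := summable_smul_of_abs_le_one
      (fun x η => abs_occ_sub_meanOcc_le (slowlyVaryingBernoulli ρ₀ n) η x)
      (summable_norm_latticeKernel n) η
    have e : inner ℝ (kernelField n (slowlyVaryingBernoulli ρ₀ n) η) h
        = ∑' x, a n x * (occ η x - meanOcc (slowlyVaryingBernoulli ρ₀ n) x) := by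
      rw [real_inner_comm, kernelField, ← innerSL_apply_apply ℝ, (innerSL ℝ h).map_tsum hs]
      refine tsum_congr fun x => ?_
      rw [map_smul, innerSL_apply_apply, smul_eq_mul, real_inner_comm, mul_comm]
    rw [e]
  have hsqrt : Tendsto (fun n : ℕ => 2 * ‖h‖ / √(n : ℝ)) atTop (𝓝 0) :=
    tendsto_const_nhds.div_atTop
      (Real.tendsto_sqrt_atTop.comp tendsto_natCast_atTop_atTop)
  have hG : Tendsto (fun n : ℕ => Complex.exp (-(∑' x : ℤ,
      (∫ η, (occ η x - meanOcc (slowlyVaryingBernoulli ρ₀ n) x) ^ 2 ∂slowlyVaryingBernoulli ρ₀ n)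
        * a n x ^ 2 / 2 : ℝ))) atTop (𝓝 (Complex.exp (-(covarianceForm ρ₀ h / 2 : ℝ)))) := by
    have hc : Continuous fun y : ℝ => Complex.exp (-(y : ℂ)) := by fun_prop
    refine (hc.tendsto _).comp ?_
    have hR := (tendsto_riemannSum (abs_chi_mul_inner_kernel_sq_le ρ₀ h) fun u hu => by
      have h1 : Continuous fun u => chi (ρ₀ u) := by unfold chi; fun_prop
      exact h1.continuousAt.mul (((continuousAt_kernel hu).inner continuousAt_const).pow 2)).div_const 2
    refine hR.congr fun n => ?_
    simp_rw [integral_sq_occ_sub_meanOcc, ha2]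
    rw [← tsum_mul_left, ← tsum_div_const]
    exact tsum_congr fun x => by ring
  have hdiff : Tendsto (fun n => charFun (kernelFieldLaw ρ₀ n : Measure KernelSpace) h
      - Complex.exp (-(∑' x : ℤ,
      (∫ η, (occ η x - meanOcc (slowlyVaryingBernoulli ρ₀ n) x) ^ 2 ∂slowlyVaryingBernoulli ρ₀ n)
        * a n x ^ 2 / 2 : ℝ))) atTop (𝓝 0) := by
    have hbound : Tendsto (fun n : ℕ => 4 * (2 * ‖h‖ / √(n : ℝ) * (4 * ‖h‖ ^ 2 * (3 * Real.pi))))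
        atTop (𝓝 0) := by
      simpa using (hsqrt.mul_const (4 * ‖h‖ ^ 2 * (3 * Real.pi))).const_mul 4
    refine squeeze_zero_norm' ?_ hbound
    -- The Gaussian approximation requires `|a n x| ≤ 1`, which holds once `2‖h‖ ≤ √n`.
    filter_upwards [hsqrt.eventually_le_const one_pos] with n hn
    rw [hchar]
    refine (norm_integral_exp_tsum_sub_exp_le
      (fun x => measurable_occ_sub_meanOcc (slowlyVaryingBernoulli ρ₀ n) x)
      (fun x η => abs_occ_sub_meanOcc_le (slowlyVaryingBernoulli ρ₀ n) η x)
      (integral_occ_sub_meanOcc ρ₀ n) (iIndepFun_occ_sub_meanOcc ρ₀ n)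
      (fun x => (hamax n x).trans hn) (hasum n)).trans ?_
    have hle : ∀ x, |a n x| ^ 3 ≤ 2 * ‖h‖ / √(n : ℝ) * |a n x| ^ 2 := fun x => by
      rw [pow_succ' _ 2]
      exact mul_le_mul_of_nonneg_right (hamax n x) (by positivity)
    have hs3 := Summable.of_nonneg_of_le (fun x => by positivity) hle ((hsq n).1.mul_left _)
    refine mul_le_mul_of_nonneg_left ?_ (by norm_num)
    refine (hs3.tsum_le_tsum hle ((hsq n).1.mul_left _)).trans ?_
    rw [tsum_mul_left]
    exact mul_le_mul_of_nonneg_left (hsq n).2 (by positivity)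
  simpa using hdiff.add hG

end KernelField

/-! ### The limiting Gaussian law and the passage to the dual space -/

section GaussianLimit

variable {ρ₀ : ℝ → unitInterval} {ν : Measure KernelSpace} [IsProbabilityMeasure ν]

lemma covarianceForm_nonneg (ρ₀ : ℝ → unitInterval) (h : KernelSpace) : 0 ≤ covarianceForm ρ₀ h :=
  integral_nonneg fun _ => mul_nonneg (chi_nonneg _) (sq_nonneg _)

lemma covarianceForm_smul (ρ₀ : ℝ → unitInterval) (t : ℝ) (h : KernelSpace) :
    covarianceForm ρ₀ (t • h) = t ^ 2 * covarianceForm ρ₀ h := by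
  rw [covarianceForm, covarianceForm, ← integral_const_mul]
  congr 1
  ext u
  rw [real_inner_smul_right]
  ring

/-- Along the line `t • h` the quadratic form scales by `t²`, which gives a centred Gaussian
characteristic function in `t`. -/
lemma map_inner_eq_gaussianReal
    (hν : ∀ h, charFun ν h = Complex.exp (-(covarianceForm ρ₀ h / 2 : ℝ))) (h : KernelSpace) :
    ν.map (fun x => inner ℝ x h) = gaussianReal 0 (covarianceForm ρ₀ h).toNNReal := by
  have hm : Measurable fun x : KernelSpace => inner ℝ x h := Continuous.measurable (by fun_prop)
  have := Measure.isProbabilityMeasure_map (μ := ν) hm.aemeasurable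
  refine Measure.ext_of_charFun ?_
  ext t
  have e := hν (t • h)
  rw [charFun_apply] at e
  rw [charFun_gaussianReal, charFun_apply_real, integral_map hm.aemeasurable (by fun_prop)]
  simp_rw [real_inner_smul_right, Complex.ofReal_mul] at e
  rw [e, covarianceForm_smul, Real.coe_toNNReal _ (covarianceForm_nonneg _ _)]
  congr 1
  push_cast
  ring

lemma isGaussian_of_charFun
    (hν : ∀ h, charFun ν h = Complex.exp (-(covarianceForm ρ₀ h / 2 : ℝ))) : IsGaussian ν := by
  refine isGaussian_of_map_eq_gaussianReal fun L =>
    ⟨0, (covarianceForm ρ₀ ((InnerProductSpace.toDual ℝ KernelSpace).symm L)).toNNReal, ?_⟩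
  rw [← map_inner_eq_gaussianReal hν]
  congr 1
  ext x
  rw [real_inner_comm, InnerProductSpace.toDual_symm_apply]

lemma integral_inner_of_charFun
    (hν : ∀ h, charFun ν h = Complex.exp (-(covarianceForm ρ₀ h / 2 : ℝ))) (h : KernelSpace) :
    ∫ x, inner ℝ x h ∂ν = 0 := by
  have hm : Measurable fun x : KernelSpace => inner ℝ x h := Continuous.measurable (by fun_prop)
  have e : ∫ y, y ∂ν.map (fun x => inner ℝ x h) = 0 := by
    rw [map_inner_eq_gaussianReal hν, integral_id_gaussianReal]
  rwa [integral_map hm.aemeasurable (by fun_prop)] at e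

lemma memLp_inner_of_charFun
    (hν : ∀ h, charFun ν h = Complex.exp (-(covarianceForm ρ₀ h / 2 : ℝ))) (h : KernelSpace) :
    MemLp (fun x => inner ℝ x h) 2 ν := by
  have hm : Measurable fun x : KernelSpace => inner ℝ x h := Continuous.measurable (by fun_prop)
  have e : MemLp id 2 (ν.map fun x => inner ℝ x h) := by
    rw [map_inner_eq_gaussianReal hν]
    exact memLp_id_gaussianReal 2
  exact (memLp_map_measure_iff (by fun_prop) hm.aemeasurable).1 e

lemma integral_inner_sq_of_charFun
    (hν : ∀ h, charFun ν h = Complex.exp (-(covarianceForm ρ₀ h / 2 : ℝ))) (h : KernelSpace) :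
    ∫ x, inner ℝ x h ^ 2 ∂ν = covarianceForm ρ₀ h := by
  have hm : Measurable fun x : KernelSpace => inner ℝ x h := Continuous.measurable (by fun_prop)
  have e : Var[fun y => y; ν.map (fun x => inner ℝ x h)] = covarianceForm ρ₀ h := by
    rw [map_inner_eq_gaussianReal hν, variance_fun_id_gaussianReal,
      Real.coe_toNNReal _ (covarianceForm_nonneg _ _)]
  rw [variance_map (by fun_prop) hm.aemeasurable, variance_eq_integral (by fun_prop)] at e
  simpa [integral_inner_of_charFun hν] using e

lemma integrable_chi_mul_inner_sq (hρ₀ : Continuous fun u => (ρ₀ u : ℝ)) (h : KernelSpace) :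
    Integrable fun u => chi (ρ₀ u) * inner ℝ (kernel u) h ^ 2 := by
  have hk : Measurable fun u => inner ℝ (kernel u) h := by
    have e : (fun u => inner ℝ (kernel u) h)
        = fun u => if 0 < u then inner ℝ (-rightKernel u) h else inner ℝ (leftKernel u) h := by
      ext u
      unfold kernel
      split_ifs <;> rfl
    rw [e]
    have h1 := continuous_leftKernel
    have h2 := continuous_rightKernel
    exact Measurable.ite measurableSet_Ioi (Continuous.measurable (by fun_prop))
      (Continuous.measurable (by fun_prop))
  have hχ : Continuous fun u => chi (ρ₀ u) := by unfold chi; fun_prop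
  exact Integrable.mono' (integrable_inv_one_add_sq.const_mul _)
    (hχ.measurable.mul (hk.pow_const 2)).aestronglyMeasurable
    (Eventually.of_forall (abs_chi_mul_inner_kernel_sq_le ρ₀ h))

/-- Polarisation, applied under both integrals to the identity for squares. -/
lemma integral_inner_mul_inner_of_charFun (hρ₀ : Continuous fun u => (ρ₀ u : ℝ))
    (hν : ∀ h, charFun ν h = Complex.exp (-(covarianceForm ρ₀ h / 2 : ℝ))) (g h : KernelSpace) :
    ∫ x, inner ℝ x g * inner ℝ x h ∂ν
      = ∫ u, chi (ρ₀ u) * inner ℝ (kernel u) g * inner ℝ (kernel u) h := by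
  have i : ∀ h : KernelSpace, Integrable (fun x => inner ℝ x h ^ 2) ν :=
    fun h => (memLp_inner_of_charFun hν h).integrable_sq
  have j := integrable_chi_mul_inner_sq hρ₀
  have e1 : ∫ x, inner ℝ x g * inner ℝ x h ∂ν
      = (covarianceForm ρ₀ (g + h) - covarianceForm ρ₀ (g - h)) / 4 := by
    rw [← integral_inner_sq_of_charFun hν, ← integral_inner_sq_of_charFun hν,
      ← integral_sub (i _) (i _), ← integral_div]
    congr 1
    ext x
    rw [inner_add_right, inner_sub_right]
    ring
  rw [e1, covarianceForm, covarianceForm, ← integral_sub (j _) (j _), ← integral_div]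
  congr 1
  ext u
  rw [inner_add_right, inner_sub_right]
  ring

end GaussianLimit

/-! ### Transport to the strong dual -/

section DualEmbedding

/-- The transpose of `weightedDeriv`, from `L²(ℝ)` to the strong dual of the test functions. -/
def dualEmbedding (α : ℝ) : KernelSpace →L[ℝ] DualSpace α :=
  (ContinuousLinearMap.precomp ℝ (weightedDeriv α)).comp (innerSL ℝ)

lemma dualEmbedding_apply {α : ℝ} (x : KernelSpace) (f : TestSpace α) :
    dualEmbedding α x f = inner ℝ x (weightedDeriv α f) := rfl

/-- The pairing with `weightedDeriv α f` is continuous, so it enters the series, where each kernel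
returns the value `f (x / n)`. -/
lemma dualEmbedding_kernelField (α : ℝ) (n : ℕ) (μ : Measure Config) [IsProbabilityMeasure μ]
    (η : Config) : dualEmbedding α (kernelField n μ η) = densityField α n μ η := by
  ext f
  have hs := summable_smul_of_abs_le_one
    (fun x η => abs_occ_sub_meanOcc_le μ η x) (summable_norm_latticeKernel n) η
  change _ = fieldValue n μ η f
  rw [dualEmbedding_apply, real_inner_comm, kernelField, ← innerSL_apply_apply ℝ,
    (innerSL ℝ (weightedDeriv α f)).map_tsum hs, fieldValue, ← tsum_mul_left]
  refine tsum_congr fun x => ?_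
  rw [map_smul, innerSL_apply_apply, real_inner_comm, latticeKernel, real_inner_smul_left,
    inner_kernel_weightedDeriv, smul_eq_mul]
  ring

/-- Finite-dimensional marginals are continuous linear images of the Gaussian measure `ν`. -/
lemma isInitialGaussianField_dualEmbedding (α : ℝ) {ρ₀ : ℝ → unitInterval}
    (hρ₀ : Continuous fun u => (ρ₀ u : ℝ)) {ν : Measure KernelSpace} [IsProbabilityMeasure ν]
    (hν : ∀ h, charFun ν h = Complex.exp (-(covarianceForm ρ₀ h / 2 : ℝ))) :
    IsInitialGaussianField ρ₀ (dualEmbedding α) ν where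
  measurable := (dualEmbedding α).continuous.measurable
  gaussian := ⟨fun I => by
    have := isGaussian_of_charFun hν
    let L : KernelSpace →L[ℝ] (I → ℝ) :=
      ContinuousLinearMap.pi fun f => innerSL ℝ (weightedDeriv α f.1)
    have h : HasGaussianLaw (fun w => L w) ν := IsGaussian.hasGaussianLaw_id.map_fun L
    have e : (fun w => I.restrict fun f : TestSpace α => dualEmbedding α w f) = fun w => L w := by
      ext w f
      exact real_inner_comm (weightedDeriv α f.1) w
    rwa [e]⟩
  mean_zero f := integral_inner_of_charFun hν _
  covariance f g := by
    simp_rw [dualEmbedding_apply]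
    rw [integral_inner_mul_inner_of_charFun hρ₀ hν]
    simp_rw [inner_kernel_weightedDeriv]

end DualEmbedding

end SlowBond

end

theorem propositionB1 (α : ℝ) (hα : 0 < α) (ρ₀ : ℝ → unitInterval)
    (hρ₀ : ContDiff ℝ ∞ (fun u => (ρ₀ u : ℝ))) :
    ∃ (Ω : Type) (_ : MeasurableSpace Ω) (P : Measure Ω) (_ : IsProbabilityMeasure P)
      (Y₀ : Ω → SlowBond.DualSpace α),
      SlowBond.IsInitialGaussianField ρ₀ Y₀ P ∧
      TendstoInDistribution
        (fun n : ℕ => SlowBond.densityField α n (SlowBond.slowlyVaryingBernoulli ρ₀ n))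
        atTop Y₀ (fun n : ℕ => SlowBond.slowlyVaryingBernoulli ρ₀ n) P := by
  obtain ⟨ν, hν, hlim⟩ := SlowBond.exists_tendsto_of_isTightMeasureSet_of_charFun
    (SlowBond.isTightMeasureSet_kernelFieldLaw ρ₀)
    (SlowBond.tendsto_charFun_kernelFieldLaw hρ₀.continuous)
  -- The limit field lives on `L²(ℝ)` itself, with the limit law `ν` as probability.
  refine ⟨SlowBond.KernelSpace, inferInstance, ν, inferInstance, SlowBond.dualEmbedding α,
    SlowBond.isInitialGaussianField_dualEmbedding α hρ₀.continuous hν, ?_⟩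
  have h : TendstoInDistribution
      (fun n : ℕ => SlowBond.kernelField n (SlowBond.slowlyVaryingBernoulli ρ₀ n)) atTop
      (id : SlowBond.KernelSpace → SlowBond.KernelSpace)
      (fun n : ℕ => SlowBond.slowlyVaryingBernoulli ρ₀ n) (ν : Measure SlowBond.KernelSpace) :=
    { forall_aemeasurable := fun n => (SlowBond.measurable_kernelField n _).aemeasurable
      aemeasurable_limit := aemeasurable_id
      tendsto := by
        have e : (⟨(ν : Measure SlowBond.KernelSpace).map id,
            Measure.isProbabilityMeasure_map aemeasurable_id⟩ :
            ProbabilityMeasure SlowBond.KernelSpace) = ν := Subtype.ext Measure.map_id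
        rw [e]
        exact hlim }
  -- Continuity into the strong topology gives both Borel measurability of the fields and the
  -- continuous mapping argument.
  have h' := h.continuous_comp (SlowBond.dualEmbedding α).continuous
  rw [Function.comp_id] at h'
  have e : (fun n : ℕ => SlowBond.densityField α n (SlowBond.slowlyVaryingBernoulli ρ₀ n))
      = fun n => SlowBond.dualEmbedding α ∘
        SlowBond.kernelField n (SlowBond.slowlyVaryingBernoulli ρ₀ n) := by
    ext1 n
    ext1 η
    exact (SlowBond.dualEmbedding_kernelField α n _ η).symm
  rw [e]
  exact h'
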